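/- **The MDPs.** For $H\ge 2$ and $b\in\{0,1\}^{H-2}$ let $M_{H,b}$ be the following MDP with horizon $H$ and actions $\{0,1\}$. A state is a time $t\in\{0,\dots,H\}$ with a vector in $\mathbb R^{3(H-2)+1}$ with coordinates $s^{a,i}$, $s^{u,i}$, $s^{d,i}$ ($1\le i\le H-2$) and $s^c$. The initial state is the zero vector at $t=0$. At step $0$, whatever the action, the next vector is, with probability $1/2$ each, zero (left branch) or zero except for $s^c=1$ (right branch), with reward $0$. On the left branch the vector stays zero with reward $0$, until at the last step ($t=H-1$), whatever the action, one obtains with probability $1/3$ reward $1$ and the end vector $s^{u,i}=1$ for all $i$, $s^a=0,\ s^d=0,\ s^c=0$, and with probability $2/3$ reward $0$ and the zero vector. On the right branch the step $1\le t\le H-2$ writes the action $a_t$ into $s^{a,t}$, with reward $0$; the last step leads to the end vector $s^{u,i}=1$ if $s^{a,i}=b_i$ and $0$ otherwise, $s^{d,i}=1-s^{u,i}$, $s^a=0$, $s^c=0$, with reward $1$ if all recorded actions agree with $b$ and $0$ otherwise. The state space $\mathcal S_H$ consists of the zero vectors (all $t$), the right-branch vectors at times $1\le t\le H-1$ (binary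 $s^a$ with $s^{a,i}=0$ for $i\ge t$, $s^u=s^d=0$, $s^c=1$), and the end vectors at time $H$ with binary $s^u$, $s^d=1-s^u$, $s^a=0$, $s^c=0$; it does not depend on $b$. **The goal-conditioned algorithm**, with parameters $N,\alpha$: draw $N$ independent trajectories $(s_0,a_0,r_0,\dots,s_H)$ with uniformly random actions; let $g$ be a final state of the sample with maximal last reward; for every $t<H$ choose $w^t$ minimising, over the $w$ with at most $\alpha$ non-zero entries, the number of sampled trajectories for which $\mathbf 1[\langle w,(s_t,s_H)\rangle>0]\ne a_t$ (vectors concatenated); return the policy that plays $\mathbf 1[\langle w^t,(s_t,g)\rangle>0]$ at $s_t$. Ties are broken arbitrarily. **Interface algorithms.** An interface for an MDP keeps a list of states (a pointer is an index in it) and a dataset $D\in(\mathcal S\times X)^*$, where $X$ is any set; both are empty at the start. The calls are: *init*($\mathcal F$) draws an initial state $s$, stores it, and returns $s$, its pointer and $[f(s,D)]_{f\in\mathcal F}$; *step*($\bar s,a,g,\mathcal F$), if the state $s$ with pointer $\bar s$ is not final, draws $(r,s')\sim P(\cdot|s,a)$, stores $s'$, computes $v=[f(s',D)]_{f\in\mathcal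 F}$, appends $(s,g(a,r,v))$ to $D$ and returns $s,a,r$, the pointer of $s'$ and $v$, and it returns $\bot$ otherwise; *evaluate*($s,\mathcal F$), for $s\in\mathcal S$, returns $[f(s,D)]_{f\in\mathcal F}$; *encode*($s$), for $s\in\mathcal S$, stores $s$ and returns its pointer; *reset* empties $D$. Here $\mathcal F$ is a finite sequence of functions $f:\mathcal S\times(\mathcal S\times X)^*\to\mathbb R$ with $f(s,((s_0,x_0),\dots))=f(p(s),((p(s_0),x_0),\dots))$ for every permutation $p$ of the vector coordinates for which all these states lie in $\mathcal S$, and $g$ is any function into $X$. An interface algorithm has a random seed and accesses the MDP only by adaptively chosen calls; it returns a policy that may again call the interface, starting from the interface memory left by learning, to determine its action distribution at a given state. It uses at most $K$ calls on an MDP if, almost surely, learning followed by one decision of the returned policy, at any state, makes at most $K$ calls. **Theorem.** 1. There are polynomials $P,Q$ in two variables and one program for a random access machine with real arrays (unit-cost instructions: addition and subtraction of indices, addition, subtraction, multiplication and comparison of reals, indexed reading and writing, conditionals, bounded loops) such that for all $H\ge2$ and $\delta\in(0,1)$ there is a sample size $N\le P(H,1/\delta)$ with the following properties. On every set of $N$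 trajectories, the program computes a goal $g$ and weights $w^0,\dots,w^{H-1}$ as the goal-conditioned algorithm with $\alpha=1$ prescribes, and the number of its steps plus the number of recorded sample entries is at most $Q(H,1/\delta)$. For every $b\in\{0,1\}^{H-2}$, with probability at least $1-\delta$ over the sample from $M_{H,b}$, the policy returned by the goal-conditioned algorithm with $\alpha=1$ is optimal for $M_{H,b}$, however ties are broken. 2. For every sequence $(A_H)_{H\ge2}$ of interface algorithms such that $A_H$ uses at most $K(H)$ calls on every $M_{H,b}$, where $K(H)=o(2^H)$, and for all sufficiently large $H$, there is $b\in\{0,1\}^{H-2}$ such that $A_H$ on $M_{H,b}$ outputs a suboptimal policy with probability at least $1/3$. -/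

import Mathlib

open Filter Asymptotics MeasureTheory

universe u v

/-! ### Finite-horizon MDPs with binary actions and real state vectors

A state is a pair `(t, x)` of a time step and a vector of `ℝ^n`; actions are Booleans. -/

/-- States `(t, x)`. -/
abbrev MState (n : ℕ) : Type := ℕ × (Fin n → ℝ)

/-- A finite-horizon MDP with horizon `H`, state space `states ⊆ {0, …, H} × ℝ^n`, binary actions,
initial law `start = P(· | ⊥)` and transition law `step s a = P(r, s' | s, a)`.  The values of
`step` outside of the non-final states of `states` are irrelevant. -/
structure MDP (n H : ℕ) where
  states : Set (MState n)
  start : PMF (MState n)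
  step : MState n → Bool → PMF (ℝ × MState n)
  time_le : ∀ s ∈ states, s.1 ≤ H
  start_mem : ∀ s ∈ start.support, s ∈ states ∧ s.1 = 0
  step_mem : ∀ s ∈ states, s.1 < H → ∀ a, ∀ o ∈ (step s a).support,
    o.2 ∈ states ∧ o.2.1 = s.1 + 1

/-- A trajectory `(s_0, a_0, r_0, s_1, …, s_H)`. -/
structure Traj (n H : ℕ) where
  state : Fin (H + 1) → MState n
  act : Fin H → Bool
  rew : Fin H → ℝ

/-- Prefix a trajectory by one transition. -/
def Traj.cons {n k : ℕ} (s : MState n) (a : Bool) (r : ℝ) (τ : Traj n k) : Traj n (k + 1) where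
  state := Fin.cons s τ.state
  act := Fin.cons a τ.act
  rew := Fin.cons r τ.rew

/-- Sum of the rewards of a trajectory. -/
def Traj.ret {n H : ℕ} (τ : Traj n H) : ℝ := ∑ t, τ.rew t

namespace MDP

variable {n H : ℕ}

/-- Law of the next `k` transitions from the state `s`, under the policy `π`. -/
noncomputable def rollout (M : MDP n H) (π : MState n → PMF Bool) :
    (k : ℕ) → MState n → PMF (Traj n k)
  | 0, s => PMF.pure ⟨fun _ => s, Fin.elim0, Fin.elim0⟩
  | k + 1, s => (π s).bind fun a => (M.step s a).bind fun o =>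
      (M.rollout π k o.2).map (Traj.cons s a o.1)

/-- The law `P^π` of a whole trajectory. -/
noncomputable def trajLaw (M : MDP n H) (π : MState n → PMF Bool) : PMF (Traj n H) :=
  M.start.bind (M.rollout π H)

/-- Expected cumulative reward of a policy. -/
noncomputable def value (M : MDP n H) (π : MState n → PMF Bool) : ℝ :=
  ∑' τ, (M.trajLaw π τ).toReal * τ.ret

/-- Optimal policies. -/
def IsOptimal (M : MDP n H) (π : MState n → PMF Bool) : Prop :=
  ∀ π' : MState n → PMF Bool, M.value π' ≤ M.value π

end MDP

/-- The policy `π^U` that draws actions uniformly. -/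
noncomputable def uniformPolicy (n : ℕ) : MState n → PMF Bool :=
  fun _ => PMF.uniformOfFintype Bool

/-- Law of `N` independent draws from `p`. -/
noncomputable def iidLaw {β : Type v} (p : PMF β) : (N : ℕ) → PMF (Fin N → β)
  | 0 => PMF.pure Fin.elim0
  | N + 1 => p.bind fun x => (iidLaw p N).map (Fin.cons x)

/-! ### The family of MDPs

`m = H - 2` is the length of the hidden word `b`, and a state vector
`[s^{a,1}, …, s^{a,m}, s^{b,u,1}, s^{b,d,1}, …, s^{b,u,m}, s^{b,d,m}, s^c]` has `3 m + 1`
coordinates. -/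

/-- The real number `1` or `0` that stands for a truth value. -/
def bitR (c : Bool) : ℝ := if c then 1 else 0

/-- The vector with parts `a`, `(u, d)` and `c`. -/
def mkVec {m : ℕ} (a u d : Fin m → ℝ) (c : ℝ) : Fin (3 * m + 1) → ℝ := fun j =>
  if h : j.1 < m then a ⟨j.1, h⟩
  else if h' : j.1 < 3 * m then
    if (j.1 - m) % 2 = 0 then u ⟨(j.1 - m) / 2, by omega⟩ else d ⟨(j.1 - m) / 2, by omega⟩
  else c

/-- The coordinate `s^{a,i+1}`. -/
def aPart {m : ℕ} (x : Fin (3 * m + 1) → ℝ) (i : Fin m) : ℝ := x ⟨i.1, by omega⟩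

/-- The coordinate `s^c`. -/
def cPart {m : ℕ} (x : Fin (3 * m + 1) → ℝ) : ℝ := x (Fin.last _)

/-- Vector of a right-branch state before the last step: `w` holds the recorded actions. -/
def rightVec {m : ℕ} (w : Fin m → Bool) : Fin (3 * m + 1) → ℝ :=
  mkVec (fun i => bitR (w i)) 0 0 1

/-- Vector of a final state whose `u` part is `w` and whose `d` part is the complement of `w`. -/
def endVec {m : ℕ} (w : Fin m → Bool) : Fin (3 * m + 1) → ℝ :=
  mkVec 0 (fun i => bitR (w i)) (fun i => bitR (!w i)) 0

/-- The word of the actions recorded in a right-branch state. -/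
noncomputable def recorded {m : ℕ} (x : Fin (3 * m + 1) → ℝ) : Fin m → Bool :=
  fun i => decide (aPart x i = 1)

/-- The state space of the family; it does not depend on the hidden word. -/
def familyStates (m : ℕ) : Set (MState (3 * m + 1)) :=
  {s | s.1 ≤ m + 2 ∧ s.2 = 0} ∪
  {s | 1 ≤ s.1 ∧ s.1 ≤ m + 1 ∧
    ∃ w : Fin m → Bool, (∀ i : Fin m, s.1 ≤ i.1 + 1 → w i = false) ∧ s.2 = rightVec w} ∪
  {s | s.1 = m + 2 ∧ ∃ w : Fin m → Bool, s.2 = endVec w}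

/-- The transition law.  Step `0`: a fair coin chooses the left branch (zero vector) or the right
branch (only `s^c = 1`).  Left branch: the vector stays zero, except that the last step gives, with
probability `1/3`, reward `1` and the end vector `u = 1, d = 0`.  Right branch: step `1 ≤ t ≤ m`
records the action in `s^{a,t}`, and the last step compares the recorded word with `b` and gives
reward `1` if and only if they agree. -/
noncomputable def familyStep (m : ℕ) (b : Fin m → Bool) (s : MState (3 * m + 1)) (a : Bool) :
    PMF (ℝ × MState (3 * m + 1)) :=
  if s.1 = 0 then
    (PMF.uniformOfFintype Bool).map fun right =>
      (0, (1, if right then rightVec (fun _ => false) else 0))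
  else if s.1 = m + 1 then
    if cPart s.2 = 0 then
      (PMF.uniformOfFintype (Fin 3)).map fun k =>
        if k = 0 then (1, (m + 2, endVec (fun _ => true))) else (0, (m + 2, 0))
    else
      PMF.pure (if recorded s.2 = b then 1 else 0,
        (m + 2, endVec (fun i => recorded s.2 i == b i)))
  else
    PMF.pure (0, (s.1 + 1,
      if cPart s.2 = 0 then s.2
      else fun j => if j.1 + 1 = s.1 then bitR a else s.2 j))

theorem cPart_mkVec {m : ℕ} (a u d : Fin m → ℝ) (c : ℝ) : cPart (mkVec a u d c) = c := by
  simp [cPart, mkVec, Fin.last, show ¬ 3 * m < m by omega]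

theorem rightVec_update {m : ℕ} (w : Fin m → Bool) (t : ℕ) (h1 : t ≤ m) (a : Bool) :
    (fun j : Fin (3 * m + 1) => if j.1 + 1 = t then bitR a else rightVec w j) =
      rightVec (fun i => if i.1 + 1 = t then a else w i) := by
  funext j
  by_cases hj : j.1 < m
  · by_cases hjt : j.1 + 1 = t <;> simp [rightVec, mkVec, hj, hjt]
  · have : ¬ j.1 + 1 = t := by omega
    simp [rightVec, mkVec, hj, this]

/-- The MDP of the family with horizon `H = m + 2` and hidden word `b`. -/
noncomputable def familyMDP (m : ℕ) (b : Fin m → Bool) : MDP (3 * m + 1) (m + 2) where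
  states := familyStates m
  start := PMF.pure (0, 0)
  step := familyStep m b
  time_le := by
    rintro s ((h | h) | h)
    · exact h.1
    · have := h.2.1; omega
    · exact h.1.le
  start_mem := by
    intro s hs
    rw [PMF.support_pure, Set.mem_singleton_iff] at hs
    subst hs
    exact ⟨Or.inl (Or.inl ⟨Nat.zero_le _, rfl⟩), rfl⟩
  step_mem := by
    intro s hs hlt a o ho
    unfold familyStep at ho
    by_cases h0 : s.1 = 0
    · rw [if_pos h0, PMF.support_map] at ho
      obtain ⟨c, -, rfl⟩ := ho
      refine ⟨?_, by simp [h0]⟩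
      cases c
      · exact Or.inl (Or.inl ⟨by simp, by simp⟩)
      · exact Or.inl (Or.inr ⟨le_rfl, by simp, fun _ => false, by simp, by simp⟩)
    rw [if_neg h0] at ho
    by_cases h1 : s.1 = m + 1
    · rw [if_pos h1] at ho
      by_cases h2 : cPart s.2 = 0
      · rw [if_pos h2, PMF.support_map] at ho
        obtain ⟨c, -, rfl⟩ := ho
        by_cases hc : c = 0
        · simp only [hc, if_true]
          exact ⟨Or.inr ⟨rfl, fun _ => true, rfl⟩, by omega⟩
        · simp only [hc, if_false]
          exact ⟨Or.inl (Or.inl ⟨le_rfl, rfl⟩), by omega⟩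
      · rw [if_neg h2, PMF.support_pure, Set.mem_singleton_iff] at ho
        subst ho
        exact ⟨Or.inr ⟨rfl, fun i => recorded s.2 i == b i, rfl⟩, by simp [h1]⟩
    · rw [if_neg h1, PMF.support_pure, Set.mem_singleton_iff] at ho
      subst ho
      refine ⟨?_, rfl⟩
      rcases hs with (hs | hs) | hs
      · refine Or.inl (Or.inl ⟨hlt, ?_⟩)
        simp [hs.2, cPart]
      · obtain ⟨-, h3, w, hw, hx⟩ := hs
        have hc : ¬ cPart s.2 = 0 := by
          rw [hx, rightVec, cPart_mkVec]
          exact one_ne_zero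
        refine Or.inl (Or.inr ⟨Nat.succ_pos _, by simp only; omega,
          fun i => if i.1 + 1 = s.1 then a else w i, ?_, ?_⟩)
        · intro i hi
          simp only at hi ⊢
          rw [if_neg (by omega)]
          exact hw i (by omega)
        · simp only [if_neg hc]
          rw [hx]
          exact rightVec_update w s.1 (by omega) a
      · exact absurd hs.1 (by omega)

/-! ### The goal-conditioned algorithm -/

/-- The threshold classifier `x ↦ δ(⟨w, x⟩ > 0)`. -/
noncomputable def thresh {k : ℕ} (w x : Fin k → ℝ) : Bool := decide (0 < w ⬝ᵥ x)

/-- The number of non-zero weights. -/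
noncomputable def l0norm {k : ℕ} (w : Fin k → ℝ) : ℕ := (Finset.univ.filter fun j => w j ≠ 0).card

/-- Number of errors of the classifier `w` on the pairs `((s_t, s_H), a_t)` of the dataset. -/
noncomputable def empErr {n H N : ℕ} (D : Fin N → Traj n H) (t : Fin H)
    (w : Fin (n + n) → ℝ) : ℕ :=
  (Finset.univ.filter fun i : Fin N =>
    thresh w (Fin.append ((D i).state t.castSucc).2 ((D i).state (Fin.last H)).2)
      ≠ (D i).act t).card

/-- `(g, w)` is a possible outcome of the goal-conditioned algorithm on the dataset `D`, with
parameter `α`: `g` is (the real part of) a final state of `D` that was entered with maximal reward,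
and for every `t` the weights `w t` minimise the number of errors among those with at most `α`
non-zero entries.  Ties in both optimisations are broken arbitrarily. -/
def IsGCOutput {n h N : ℕ} (α : ℕ) (D : Fin N → Traj n (h + 1)) (g : Fin n → ℝ)
    (w : Fin (h + 1) → Fin (n + n) → ℝ) : Prop :=
  (∃ i, g = ((D i).state (Fin.last (h + 1))).2 ∧
    ∀ i', (D i').rew (Fin.last h) ≤ (D i).rew (Fin.last h)) ∧
  ∀ t, l0norm (w t) ≤ α ∧ ∀ w', l0norm w' ≤ α → empErr D t (w t) ≤ empErr D t w'

/-- The returned policy: at `s_t`, play the action predicted by `f^t` from `(s_t, g)`. -/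
noncomputable def gcPolicy {n H : ℕ} (g : Fin n → ℝ) (w : Fin H → Fin (n + n) → ℝ) :
    MState n → PMF Bool := fun s =>
  if h : s.1 < H then PMF.pure (thresh (w ⟨s.1, h⟩) (Fin.append s.2 g)) else PMF.pure false

/-! ### A random access machine with real arrays, and its step count -/

/-- Memory: natural-number registers (for indices and counters), real registers, and real arrays
`arr k`, addressed by triples of indices. -/
structure RStore where
  nreg : ℕ → ℕ
  rreg : ℕ → ℝ
  arr : ℕ → ℕ → ℕ → ℕ → ℝ

/-- Programs.  They are finite objects: all register numbers, array names `k` and constants are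
fixed in the program text, and array indices are taken from registers. -/
inductive RCmd where
  | skip
  | seq (c d : RCmd)
  | nconst (x c : ℕ)
  | nadd (x y z : ℕ)
  | nsub (x y z : ℕ)
  | rconst (x : ℕ) (c : ℤ)
  | radd (x y z : ℕ)
  | rsub (x y z : ℕ)
  | rmul (x y z : ℕ)
  | read (x k i j l : ℕ)
  | write (k i j l x : ℕ)
  | nifLt (x y : ℕ) (c d : RCmd)
  | rifLt (x y : ℕ) (c d : RCmd)
  | loop (x : ℕ) (c : RCmd)

open Classical in
/-- Execution: final memory and number of steps.  Every elementary instruction, every test and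
every start or repetition of a loop costs one step; `loop x c` repeats `c` as many times as the
register `x` says when the loop is entered. -/
noncomputable def RCmd.exec : RCmd → RStore → RStore × ℕ
  | skip, σ => (σ, 1)
  | seq c d, σ => ((d.exec (c.exec σ).1).1, (c.exec σ).2 + (d.exec (c.exec σ).1).2)
  | nconst x c, σ => ({ σ with nreg := Function.update σ.nreg x c }, 1)
  | nadd x y z, σ => ({ σ with nreg := Function.update σ.nreg x (σ.nreg y + σ.nreg z) }, 1)
  | nsub x y z, σ => ({ σ with nreg := Function.update σ.nreg x (σ.nreg y - σ.nreg z) }, 1)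
  | rconst x c, σ => ({ σ with rreg := Function.update σ.rreg x (c : ℝ) }, 1)
  | radd x y z, σ => ({ σ with rreg := Function.update σ.rreg x (σ.rreg y + σ.rreg z) }, 1)
  | rsub x y z, σ => ({ σ with rreg := Function.update σ.rreg x (σ.rreg y - σ.rreg z) }, 1)
  | rmul x y z, σ => ({ σ with rreg := Function.update σ.rreg x (σ.rreg y * σ.rreg z) }, 1)
  | read x k i j l, σ =>
      (⟨σ.nreg, Function.update σ.rreg x (σ.arr k (σ.nreg i) (σ.nreg j) (σ.nreg l)), σ.arr⟩, 1)
  | write k i j l x, σ =>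
      ({ σ with arr := fun k' i' j' l' =>
          if k' = k ∧ i' = σ.nreg i ∧ j' = σ.nreg j ∧ l' = σ.nreg l then σ.rreg x
          else σ.arr k' i' j' l' }, 1)
  | nifLt x y c d, σ =>
      if σ.nreg x < σ.nreg y then ((c.exec σ).1, (c.exec σ).2 + 1)
      else ((d.exec σ).1, (d.exec σ).2 + 1)
  | rifLt x y c d, σ =>
      if σ.rreg x < σ.rreg y then ((c.exec σ).1, (c.exec σ).2 + 1)
      else ((d.exec σ).1, (d.exec σ).2 + 1)
  | loop x c, σ =>
      (fun p : RStore × ℕ => ((c.exec p.1).1, p.2 + (c.exec p.1).2 + 1))^[σ.nreg x] (σ, 1)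

/-- Input memory: registers `0, 1, 2` hold `N`, `H`, `n`; the arrays `0, 1, 2` hold the states
(trajectory, time, coordinate), the actions and the rewards (trajectory, time, `0`) of the dataset;
everything else is zero. -/
noncomputable def loadData {n H N : ℕ} (D : Fin N → Traj n H) : RStore where
  nreg x := if x = 0 then N else if x = 1 then H else if x = 2 then n else 0
  rreg _ := 0
  arr k i t j :=
    if hi : i < N then
      if k = 0 then
        if h : t < H + 1 ∧ j < n then ((D ⟨i, hi⟩).state ⟨t, h.1⟩).2 ⟨j, h.2⟩ else 0
      else if k = 1 then
        if h : t < H ∧ j = 0 then bitR ((D ⟨i, hi⟩).act ⟨t, h.1⟩) else 0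
      else if k = 2 then
        if h : t < H ∧ j = 0 then (D ⟨i, hi⟩).rew ⟨t, h.1⟩ else 0
      else 0
    else 0

/-- The goal, read from array `3`. -/
def outGoal (n : ℕ) (σ : RStore) : Fin n → ℝ := fun j => σ.arr 3 0 0 j

/-- The weights, read from array `4`. -/
def outWeights (n H : ℕ) (σ : RStore) : Fin H → Fin (n + n) → ℝ := fun t j => σ.arr 4 t j 0

/-- Cost of drawing and recording `N` trajectories: one operation per recorded number (for each
trajectory, `H + 1` state vectors of length `n`, `H` actions and `H` rewards). -/
def recordCost (n H N : ℕ) : ℕ := N * ((H + 1) * n + 2 * H)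

/-! ### The interface, and the algorithms that access the MDP only through it -/

/-- A permutation of the coordinates, acting on states. -/
def permState {n : ℕ} (p : Equiv.Perm (Fin n)) (s : MState n) : MState n :=
  (s.1, fun i => s.2 (p.symm i))

/-- The functions `f : 𝒮 × (𝒮 × X)^* → ℝ` with `f(s, D) = f(p(s), p(D))` for every permutation `p`
of the coordinates.  They are only ever evaluated on states of `S = 𝒮`, and the symmetry is only
required where both sides are evaluations on states of `S`. -/
structure SymFun {n : ℕ} (S : Set (MState n)) (X : Type u) where
  toFun : MState n → List (MState n × X) → ℝ
  symm : ∀ (p : Equiv.Perm (Fin n)) (s : MState n) (D : List (MState n × X)),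
    s ∈ S → permState p s ∈ S → (∀ e ∈ D, e.1 ∈ S ∧ permState p e.1 ∈ S) →
    toFun (permState p s) (D.map fun e => (permState p e.1, e.2)) = toFun s D

/-- Deterministic adaptive programs that access the MDP only through calls to the interface.  A
constructor other than `ret` is a call, with its arguments and the continuation `k` that receives
the answer; `ret` ends the program with a result. -/
inductive IProg {n : ℕ} (S : Set (MState n)) (X : Type u) (α : Type v) : Type (max u v) where
  | ret (x : α) : IProg S X α
  | envStart {N : ℕ} (F : Fin N → SymFun S X)
      (k : MState n → ℕ → (Fin N → ℝ) → IProg S X α) : IProg S X α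
  | envStep (ptr : ℕ) (a : Bool) {N : ℕ} (g : Bool → ℝ → (Fin N → ℝ) → X)
      (F : Fin N → SymFun S X)
      (k : Option (MState n × Bool × ℝ × ℕ × (Fin N → ℝ)) → IProg S X α) : IProg S X α
  | envEvaluate (s : S) {N : ℕ} (F : Fin N → SymFun S X)
      (k : (Fin N → ℝ) → IProg S X α) : IProg S X α
  | envEncode (s : S) (k : ℕ → IProg S X α) : IProg S X α
  | envReset (k : IProg S X α) : IProg S X α

/-- Memory of the interface: the list of encoded states, the dataset `D`, and the number of calls
that were made so far. -/
structure EnvState (n : ℕ) (X : Type u) where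
  ptrs : List (MState n)
  data : List (MState n × X)
  calls : ℕ

/-- The memory at the beginning. -/
def EnvState.empty (n : ℕ) (X : Type u) : EnvState n X := ⟨[], [], 0⟩

/-- Law of the result of a program and of the final memory of the interface.  A call `envStep` with
a final state, or with a pointer that was never given out, is answered by `⊥`. -/
noncomputable def IProg.run {n H : ℕ} (M : MDP n H) {S : Set (MState n)} {X : Type u}
    {α : Type v} : IProg S X α → EnvState n X → PMF (α × EnvState n X)
  | ret x, σ => PMF.pure (x, σ)
  | envStart F k, σ => M.start.bind fun s =>
      (k s σ.ptrs.length fun i => (F i).toFun s σ.data).run M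
        ⟨σ.ptrs ++ [s], σ.data, σ.calls + 1⟩
  | envStep ptr a g F k, σ =>
      match σ.ptrs[ptr]? with
      | none => (k none).run M ⟨σ.ptrs, σ.data, σ.calls + 1⟩
      | some s =>
        if s.1 < H then
          (M.step s a).bind fun o =>
            (k (some (s, a, o.1, σ.ptrs.length, fun i => (F i).toFun o.2 σ.data))).run M
              ⟨σ.ptrs ++ [o.2],
                σ.data ++ [(s, g a o.1 fun i => (F i).toFun o.2 σ.data)], σ.calls + 1⟩
        else (k none).run M ⟨σ.ptrs, σ.data, σ.calls + 1⟩
  | envEvaluate s F k, σ =>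
      (k fun i => (F i).toFun s.1 σ.data).run M ⟨σ.ptrs, σ.data, σ.calls + 1⟩
  | envEncode s k, σ =>
      (k σ.ptrs.length).run M ⟨σ.ptrs ++ [s.1], σ.data, σ.calls + 1⟩
  | envReset k, σ => k.run M ⟨σ.ptrs, [], σ.calls + 1⟩

/-- A policy that may itself call the interface to choose the law of its action at a state. -/
abbrev IPolicy {n : ℕ} (S : Set (MState n)) (X : Type u) : Type u :=
  MState n → IProg S X (PMF Bool)

/-- The policy `𝒮 → Δ(𝒜)` that is induced by an interface policy, when each of its decisions is
taken with the interface memory `σ` that learning has left. -/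
noncomputable def IPolicy.toPolicy {n H : ℕ} (M : MDP n H) {S : Set (MState n)} {X : Type u}
    (π : IPolicy S X) (σ : EnvState n X) : MState n → PMF Bool := fun s =>
  ((π s).run M σ).bind fun o => o.1

/-- A randomised RL method whose unique input is the interface: a random seed, and for each seed a
program that ends by returning a policy. -/
structure IAlg {n : ℕ} (S : Set (MState n)) where
  X : Type u
  Seed : Type v
  [mSeed : MeasurableSpace Seed]
  seedLaw : Measure Seed
  [prob : IsProbabilityMeasure seedLaw]
  learn : Seed → IProg S X (IPolicy S X)

namespace IAlg

variable {n H : ℕ} {S : Set (MState n)}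

instance (A : IAlg.{u, v} S) : MeasurableSpace A.Seed := A.mSeed

/-- On `M`, almost surely, learning followed by one decision of the returned policy, at any state,
makes at most `K` calls to the interface. -/
def CallsLe (A : IAlg.{u, v} S) (M : MDP n H) (K : ℕ) : Prop :=
  ∀ᵐ ω ∂A.seedLaw, ∀ s ∈ S,
    ∀ o ∈ ((A.learn ω).run M (EnvState.empty n A.X)).support,
      ∀ o' ∈ ((o.1 s).run M o.2).support, o'.2.calls ≤ K

/-- Probability, for a given seed, that the returned policy is suboptimal on `M`. -/
noncomputable def failProb (A : IAlg.{u, v} S) (M : MDP n H) (ω : A.Seed) : ENNReal :=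
  ((A.learn ω).run M (EnvState.empty n A.X)).toOuterMeasure
    {o | ¬ M.IsOptimal (o.1.toPolicy M o.2)}

end IAlg

/-! Upper bound. The left branch reveals the goal for free: with probability 1/6 a random trajectory
earns reward 1 there, and its end vector is the one that a right-branch run agreeing with b reaches.
On the right branch s^{u,i} tells whether the recorded action equals b_i, so one of s^{u,i}, s^{d,i}
is a copy of the action (`pathFeat_good`). A positive weight on that coordinate never errs on the
right branch, and evaluated at the goal it outputs b_i. On the left branch the actions at times 1,
..., H - 2 are noise, independent of the features. The informative classifier is compared with each
competitor through an exponential moment of the difference of their errors, computed by pairing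
trajectories that differ in one action (`errWeight_add_flip`); a competitor does at least as well
with probability at most (11/12)^N (`iidLaw_empErr_le`). Since a threshold sees only the sign of its
single weight, there are O(H) competitors per time step and a union bound suffices
(`iidLaw_gcPolicy_suboptimal_le`). For the same reason an exhaustive search over the zero classifier
and the signs ±1 on each coordinate is exact (`isGCOutput_prog`).

Lower bound. The word b enters only in the last step of the right branch. If the recorded word w
differs from b, the reward is 0, and the end vector, though it depends on b, is never returned: it
is seen only through symmetric functions. The dataset holds only non-final states, where u = d = 0,
so exchanging u- and d-coordinates fixes the dataset and moves any such end vector to any other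
(`SymFun.apply_endVec`). The answer is therefore the same for all b ≠ w, and one call singles out at
most one word. `sum_pexp_run_le` turns this into a count: a score in [0,1] whose total over b is at
most C for every fixed output totals at most C + K in expectation after K calls.

The score used is the probability of playing the first bit of b at the first right-branch state.
With m = H - 2, a fixed action law scores 2^m / 2 in total, while an optimal policy must score 1
(`family_first_of_isOptimal`). Hence the failure probabilities sum to at least 2^m / 2 - K, and once
K ≤ 2^m / 8 some word has failure probability at least 3/8. -/

/-! ### Expectations of extended nonnegative functions under a `PMF` -/

/-- Expectation of `f` under `p`. -/
noncomputable def pexp {α : Type*} (p : PMF α) (f : α → ENNReal) : ENNReal := ∑' a, p a * f a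

section pexp

variable {α β : Type*}

theorem pexp_pure (a : α) (f : α → ENNReal) : pexp (PMF.pure a) f = f a := by
  rw [pexp, tsum_eq_single a]
  · simp
  · intro b hb
    simp [PMF.pure_apply, hb]

theorem pexp_bind (p : PMF α) (q : α → PMF β) (f : β → ENNReal) :
    pexp (p.bind q) f = pexp p fun a => pexp (q a) f := by
  simp only [pexp, PMF.bind_apply, ← ENNReal.tsum_mul_right, ← ENNReal.tsum_mul_left]
  rw [ENNReal.tsum_comm]
  simp only [mul_assoc]

theorem pexp_map (p : PMF α) (g : α → β) (f : β → ENNReal) :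
    pexp (p.map g) f = pexp p fun a => f (g a) := by
  rw [← PMF.bind_pure_comp, pexp_bind]
  simp [pexp_pure]

theorem pexp_mono {p : PMF α} {f g : α → ENNReal} (h : ∀ a ∈ p.support, f a ≤ g a) :
    pexp p f ≤ pexp p g := by
  refine ENNReal.tsum_le_tsum fun a => ?_
  by_cases ha : p a = 0
  · simp [ha]
  · exact mul_le_mul_right (h a ((p.mem_support_iff a).2 ha)) _

theorem pexp_congr {p : PMF α} {f g : α → ENNReal} (h : ∀ a ∈ p.support, f a = g a) :
    pexp p f = pexp p g :=
  le_antisymm (pexp_mono fun a ha => (h a ha).le) (pexp_mono fun a ha => (h a ha).ge)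

theorem pexp_const (p : PMF α) (c : ENNReal) : pexp p (fun _ => c) = c := by
  rw [pexp, ENNReal.tsum_mul_right, p.tsum_coe, one_mul]

theorem pexp_le {p : PMF α} {f : α → ENNReal} {c : ENNReal} (h : ∀ a ∈ p.support, f a ≤ c) :
    pexp p f ≤ c :=
  (pexp_mono h).trans (pexp_const p c).le

theorem pexp_add (p : PMF α) (f g : α → ENNReal) :
    pexp p (fun a => f a + g a) = pexp p f + pexp p g := by
  simp only [pexp, mul_add, ENNReal.tsum_add]

theorem pexp_sum {ι : Type*} (p : PMF α) (s : Finset ι) (f : ι → α → ENNReal) :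
    pexp p (fun a => ∑ i ∈ s, f i a) = ∑ i ∈ s, pexp p (f i) := by
  classical
  induction s using Finset.induction_on with
  | empty => simp [pexp]
  | insert i s hi ih => simp only [Finset.sum_insert hi, pexp_add, ih]

theorem pexp_const_mul (p : PMF α) (c : ENNReal) (f : α → ENNReal) :
    pexp p (fun a => c * f a) = c * pexp p f := by
  simp only [pexp, ← ENNReal.tsum_mul_left]
  exact tsum_congr fun a => by ring

theorem pexp_uniform [Fintype α] [Nonempty α] (f : α → ENNReal) :
    pexp (PMF.uniformOfFintype α) f = (Fintype.card α : ENNReal)⁻¹ * ∑ a, f a := by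
  simp [pexp, tsum_fintype, Finset.mul_sum]

theorem pexp_bool (p : PMF Bool) (f : Bool → ENNReal) :
    pexp p f = p true * f true + p false * f false := by
  simp [pexp, tsum_fintype]

theorem toOuterMeasure_eq_pexp (p : PMF α) (s : Set α) :
    p.toOuterMeasure s = pexp p (s.indicator 1) := by
  rw [PMF.toOuterMeasure_apply]
  refine tsum_congr fun a => ?_
  by_cases ha : a ∈ s <;> simp [ha]

/-- Indicators of points are enough as test functions. This lets two laws of trajectories be
compared by expectations. -/
theorem pmf_eq_of_pexp {p q : PMF α} (h : ∀ f, pexp p f = pexp q f) : p = q := by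
  classical
  ext a
  have := h (Pi.single a 1)
  simpa [pexp, Pi.single_apply] using this

theorem toOuterMeasure_add_compl (p : PMF α) (s : Set α) :
    p.toOuterMeasure s + p.toOuterMeasure sᶜ = 1 := by
  rw [toOuterMeasure_eq_pexp, toOuterMeasure_eq_pexp, ← pexp_add]
  refine Eq.trans ?_ (pexp_const p 1)
  refine pexp_congr fun a _ => ?_
  by_cases ha : a ∈ s <;> simp [ha]

end pexp

/-! ### The value of a policy in the family -/

/-- Sum of the rewards, as an extended nonnegative number. -/
noncomputable def Traj.eret {n H : ℕ} (τ : Traj n H) : ENNReal :=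
  ∑ t, ENNReal.ofReal (τ.rew t)

theorem Traj.eret_cons {n k : ℕ} (s : MState n) (a : Bool) (r : ℝ) (τ : Traj n k) :
    (Traj.cons s a r τ).eret = ENNReal.ofReal r + τ.eret := by
  simp [Traj.eret, Traj.cons, Fin.sum_univ_succ]

namespace MDP

variable {n H : ℕ}

/-- Expected sum of the rewards of the next `k` transitions. -/
noncomputable def gain (M : MDP n H) (π : MState n → PMF Bool) (k : ℕ) (s : MState n) : ENNReal :=
  pexp (M.rollout π k s) Traj.eret

theorem gain_zero (M : MDP n H) (π : MState n → PMF Bool) (s : MState n) : M.gain π 0 s = 0 := by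
  simp [gain, rollout, pexp_pure, Traj.eret]

theorem gain_succ (M : MDP n H) (π : MState n → PMF Bool) (k : ℕ) (s : MState n) :
    M.gain π (k + 1) s = pexp (π s) fun a => pexp (M.step s a) fun o =>
      ENNReal.ofReal o.1 + M.gain π k o.2 := by
  simp only [gain, rollout, pexp_bind, pexp_map, Traj.eret_cons, pexp_add, pexp_const]

theorem rollout_rew_nonneg (M : MDP n H) (π : MState n → PMF Bool)
    (hM : ∀ s a, ∀ o ∈ (M.step s a).support, 0 ≤ o.1) (k : ℕ) :
    ∀ s, ∀ τ ∈ (M.rollout π k s).support, ∀ t, 0 ≤ τ.rew t := by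
  induction k with
  | zero => intro s τ _ t; exact t.elim0
  | succ k ih =>
    intro s τ hτ
    simp only [rollout, PMF.mem_support_bind_iff, PMF.mem_support_map_iff] at hτ
    obtain ⟨a, -, o, ho, τ', hτ', rfl⟩ := hτ
    intro t
    refine Fin.cases ?_ (fun t => ?_) t
    · simpa [Traj.cons] using hM s a o ho
    · simpa [Traj.cons] using ih _ _ hτ' t

/-- Nonnegative rewards make the passage to `ENNReal` lossless, so the recursion `gain_succ` can be
used without any summability condition. -/
theorem value_eq_gain (M : MDP n H) (π : MState n → PMF Bool)
    (hM : ∀ s a, ∀ o ∈ (M.step s a).support, 0 ≤ o.1) :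
    M.value π = (pexp M.start (M.gain π H)).toReal := by
  have h1 : pexp M.start (M.gain π H) = pexp (M.trajLaw π) Traj.eret := by
    rw [trajLaw, pexp_bind]; rfl
  rw [h1, pexp, ENNReal.tsum_toReal_eq]
  · refine tsum_congr fun τ => ?_
    rw [ENNReal.toReal_mul]
    by_cases hτ : M.trajLaw π τ = 0
    · simp [hτ]
    · congr 1
      have := (PMF.mem_support_iff _ _).2 hτ
      rw [trajLaw, PMF.mem_support_bind_iff] at this
      obtain ⟨s, -, hs⟩ := this
      have hr := rollout_rew_nonneg M π hM H s τ hs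
      rw [Traj.eret, ENNReal.toReal_sum (by simp)]
      exact Finset.sum_congr rfl fun t _ => (ENNReal.toReal_ofReal (hr t)).symm
  · intro τ
    refine ENNReal.mul_ne_top ((M.trajLaw π).apply_ne_top τ) ?_
    simp [Traj.eret]

end MDP

theorem recorded_rightVec {m : ℕ} (w : Fin m → Bool) : recorded (rightVec w) = w := by
  funext i
  have hi : i.1 < m := i.2
  cases h : w i <;> simp [recorded, aPart, rightVec, mkVec, bitR, h]

theorem cPart_rightVec {m : ℕ} (w : Fin m → Bool) : cPart (rightVec w) = 1 := by
  rw [rightVec, cPart_mkVec]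

theorem cPart_zero {m : ℕ} : cPart (0 : Fin (3 * m + 1) → ℝ) = 0 := rfl

/-! ### Gains on the two branches, and what optimality forces -/

section family

variable {m : ℕ} (b : Fin m → Bool)

theorem familyStep_zero (x : Fin (3 * m + 1) → ℝ) (a : Bool) :
    familyStep m b (0, x) a = (PMF.uniformOfFintype Bool).map fun right =>
      (0, (1, if right then rightVec (fun _ => false) else 0)) := by
  simp [familyStep]

theorem familyStep_left {t : ℕ} (h1 : 1 ≤ t) (h2 : t ≤ m) (a : Bool) :
    familyStep m b (t, 0) a = PMF.pure (0, (t + 1, 0)) := by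
  simp [familyStep, cPart_zero, show t ≠ 0 by omega, show t ≠ m + 1 by omega]

theorem familyStep_left_last (a : Bool) :
    familyStep m b (m + 1, 0) a = (PMF.uniformOfFintype (Fin 3)).map fun k =>
        if k = 0 then (1, (m + 2, endVec (fun _ => true))) else (0, (m + 2, 0)) := by
  simp [familyStep, cPart_zero]

theorem familyStep_right {t : ℕ} (h1 : 1 ≤ t) (h2 : t ≤ m) (w : Fin m → Bool) (a : Bool) :
    familyStep m b (t, rightVec w) a =
      PMF.pure (0, (t + 1, rightVec fun i => if i.1 + 1 = t then a else w i)) := by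
  simp [familyStep, cPart_rightVec, show t ≠ 0 by omega, show t ≠ m + 1 by omega,
    rightVec_update w t h2 a]

theorem familyStep_right_last (w : Fin m → Bool) (a : Bool) :
    familyStep m b (m + 1, rightVec w) a =
      PMF.pure (if w = b then 1 else 0, (m + 2, endVec fun i => w i == b i)) := by
  simp [familyStep, cPart_rightVec, recorded_rightVec]

theorem familyStep_rew_nonneg (s : MState (3 * m + 1)) (a : Bool) :
    ∀ o ∈ (familyStep m b s a).support, 0 ≤ o.1 := by
  intro o ho
  unfold familyStep at ho
  split_ifs at ho with h1 h2 h3 h4 <;>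
    simp only [PMF.mem_support_map_iff, PMF.support_pure, Set.mem_singleton_iff] at ho
  · obtain ⟨c, -, rfl⟩ := ho; simp
  · obtain ⟨c, -, rfl⟩ := ho; split_ifs <;> simp
  all_goals subst ho; simp

variable (π : MState (3 * m + 1) → PMF Bool)

theorem gain_left (k : ℕ) : ∀ t, 1 ≤ t → t + (k + 1) = m + 2 →
    (familyMDP m b).gain π (k + 1) (t, 0) = 3⁻¹ := by
  induction k with
  | zero =>
    intro t h1 h2
    obtain rfl : t = m + 1 := by omega
    rw [MDP.gain_succ]
    simp only [familyMDP, familyStep_left_last, pexp_map, MDP.gain_zero, pexp_uniform,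
      Fin.sum_univ_three]
    simp [pexp_const]
  | succ k ih =>
    intro t h1 h2
    rw [MDP.gain_succ]
    have hs : ∀ a, (familyMDP m b).step (t, 0) a = PMF.pure (0, (t + 1, 0)) :=
      fun a => familyStep_left b h1 (by omega) a
    simp only [hs, pexp_pure, ih (t + 1) (by omega) (by omega), pexp_const]
    simp

-- A bit recorded before time t is never overwritten, so one mismatch already makes the final
-- comparison fail; otherwise 1 is the largest reward still to come. The bits recorded at time t are
-- those with `i.1 + 1 < t`.
open Classical in
theorem gain_right_le (k : ℕ) : ∀ t (w : Fin m → Bool), 1 ≤ t → t + (k + 1) = m + 2 →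
    (familyMDP m b).gain π (k + 1) (t, rightVec w) ≤
      if ∀ i : Fin m, i.1 + 1 < t → w i = b i then 1 else 0 := by
  induction k with
  | zero =>
    intro t w h1 h2
    obtain rfl : t = m + 1 := by omega
    rw [MDP.gain_succ]
    simp only [familyMDP, familyStep_right_last, pexp_pure, MDP.gain_zero, pexp_const]
    have : (∀ i : Fin m, i.1 + 1 < m + 1 → w i = b i) ↔ w = b :=
      ⟨fun h => funext fun i => h i (by omega), fun h i _ => by rw [h]⟩
    simp only [this]
    split_ifs <;> simp
  | succ k ih =>
    intro t w h1 h2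
    rw [MDP.gain_succ]
    have hs : ∀ a, (familyMDP m b).step (t, rightVec w) a = PMF.pure
        (0, (t + 1, rightVec fun i => if i.1 + 1 = t then a else w i)) :=
      fun a => familyStep_right b h1 (by omega) w a
    simp only [hs, pexp_pure]
    refine pexp_le fun a _ => ?_
    simp only [ENNReal.ofReal_zero, zero_add]
    refine (ih (t + 1) _ (by omega) (by omega)).trans ?_
    split_ifs with h3 h4 h4
    · exact le_rfl
    · refine absurd (fun i hi => ?_) h4
      have := h3 i (by omega)
      rwa [if_neg (by omega)] at this
    · simp
    · simp

theorem gain_right_eq (hπ : ∀ (i : Fin m) (w : Fin m → Bool),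
      π (i.1 + 1, rightVec w) = PMF.pure (b i)) (k : ℕ) :
    ∀ t (w : Fin m → Bool), 1 ≤ t → t + (k + 1) = m + 2 →
      (∀ i : Fin m, i.1 + 1 < t → w i = b i) →
      (familyMDP m b).gain π (k + 1) (t, rightVec w) = 1 := by
  induction k with
  | zero =>
    intro t w h1 h2 hw
    obtain rfl : t = m + 1 := by omega
    rw [MDP.gain_succ]
    obtain rfl : w = b := funext fun i => hw i (by omega)
    simp [familyMDP, familyStep_right_last, pexp_pure, MDP.gain_zero, pexp_const]
  | succ k ih =>
    intro t w h1 h2 hw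
    rw [MDP.gain_succ]
    have hs : ∀ a, (familyMDP m b).step (t, rightVec w) a = PMF.pure
        (0, (t + 1, rightVec fun i => if i.1 + 1 = t then a else w i)) :=
      fun a => familyStep_right b h1 (by omega) w a
    -- Bits are numbered from 0, so the action at time t fills the bit t - 1.
    have hp := hπ ⟨t - 1, by omega⟩ w
    simp only [show t - 1 + 1 = t by omega] at hp
    simp only [hs, hp, pexp_pure, ENNReal.ofReal_zero, zero_add]
    refine ih (t + 1) _ (by omega) (by omega) fun i hi => ?_
    split_ifs with h
    · congr 1; ext; simp; omega
    · exact hw i (by omega)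

/-- The value is `1/6` from the left branch plus half of the gain on the right branch. -/
theorem family_value : (familyMDP m b).value π =
    (2⁻¹ * (3⁻¹ + (familyMDP m b).gain π (m + 1) (1, rightVec fun _ => false))).toReal := by
  rw [MDP.value_eq_gain _ _ (familyStep_rew_nonneg b)]
  have h0 : (familyMDP m b).start = PMF.pure (0, 0) := rfl
  have hs : ∀ a, (familyMDP m b).step (0, 0) a = _ := fun a => familyStep_zero b 0 a
  rw [h0, pexp_pure, MDP.gain_succ]
  simp only [hs, pexp_map, pexp_const, pexp_uniform]
  simp [gain_left b π m 1 le_rfl (by omega), add_comm]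

theorem gain_right_le_one :
    (familyMDP m b).gain π (m + 1) (1, rightVec fun _ => false) ≤ 1 := by
  classical
  refine (gain_right_le b π m 1 _ le_rfl (by omega)).trans ?_
  split_ifs <;> simp

theorem family_isOptimal_of_forall (hπ : ∀ (i : Fin m) (w : Fin m → Bool),
    π (i.1 + 1, rightVec w) = PMF.pure (b i)) : (familyMDP m b).IsOptimal π := by
  intro π'
  rw [family_value, family_value]
  refine ENNReal.toReal_mono ?_ ?_
  · rw [gain_right_eq b π hπ m 1 _ le_rfl (by omega) (by omega)]
    finiteness
  · gcongr
    rw [gain_right_eq b π hπ m 1 _ le_rfl (by omega) (by omega)]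
    exact gain_right_le_one b π'

/-- A wrong first action spoils the first bit for good and leaves gain 0, while a right one leaves
at most 1. -/
theorem gain_right_le_first (hm : 0 < m) :
    (familyMDP m b).gain π (m + 1) (1, rightVec fun _ => false) ≤
      π (1, rightVec fun _ => false) (b ⟨0, hm⟩) := by
  classical
  obtain ⟨k, rfl⟩ : ∃ k, m = k + 1 := ⟨m - 1, by omega⟩
  rw [MDP.gain_succ]
  have hs : ∀ a, (familyMDP (k + 1) b).step (1, rightVec fun _ => false) a = PMF.pure
      (0, (1 + 1, rightVec fun i => if i.1 + 1 = 1 then a else false)) :=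
    fun a => familyStep_right b le_rfl (by omega) _ a
  simp only [hs, pexp_pure, ENNReal.ofReal_zero, zero_add]
  have hle : ∀ a, (familyMDP (k + 1) b).gain π (k + 1)
      (1 + 1, rightVec fun i => if i.1 + 1 = 1 then a else false) ≤
      if a = b ⟨0, hm⟩ then 1 else 0 := by
    intro a
    refine (gain_right_le b π k 2 _ (by omega) (by omega)).trans ?_
    split_ifs with h1 h2 h2
    · exact le_rfl
    · exact absurd (by simpa using h1 ⟨0, hm⟩ (by simp)) h2
    · simp
    · simp
  refine (pexp_mono fun a _ => hle a).trans ?_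
  rw [pexp_bool]
  cases b ⟨0, hm⟩ <;> simp

/-- The only consequence of optimality that the lower bound needs: the policy commits to the first
bit of b. -/
theorem family_first_of_isOptimal (hm : 0 < m) (h : (familyMDP m b).IsOptimal π) :
    π (1, rightVec fun _ => false) (b ⟨0, hm⟩) = 1 := by
  -- The competitor plays b along the whole right branch and has gain 1 there.
  have h1 := h fun s => PMF.pure (if h : 1 ≤ s.1 ∧ s.1 ≤ m then b ⟨s.1 - 1, by omega⟩ else false)
  rw [family_value, family_value, gain_right_eq b _ (fun i w => by simp) m 1 _
    le_rfl (by omega) (by omega)] at h1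
  have hle := gain_right_le_one b π
  have h2 : 1 ≤ (familyMDP m b).gain π (m + 1) (1, rightVec fun _ => false) := by
    have h3 := (ENNReal.toReal_le_toReal (by finiteness)
      (ENNReal.mul_ne_top (by simp) (ENNReal.add_ne_top.2
        ⟨by simp, ne_top_of_le_ne_top ENNReal.one_ne_top hle⟩))).1 h1
    rw [ENNReal.mul_le_mul_iff_right (by simp) (by simp)] at h3
    exact (ENNReal.add_le_add_iff_left (by simp)).1 h3
  exact le_antisymm (PMF.coe_le_one _ _) (h2.trans (gain_right_le_first b π hm))

end family

/-! ### Sequential composition of interface programs -/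

namespace IProg

variable {n H : ℕ} {S : Set (MState n)} {X : Type u} {α β : Type*}

/-- Run `f` on the result of a program. -/
def bind : IProg S X α → (α → IProg S X β) → IProg S X β
  | ret x, f => f x
  | envStart F k, f => envStart F fun s i v => (k s i v).bind f
  | envStep ptr a g F k, f => envStep ptr a g F fun o => (k o).bind f
  | envEvaluate s F k, f => envEvaluate s F fun v => (k v).bind f
  | envEncode s k, f => envEncode s fun i => (k i).bind f
  | envReset k, f => envReset (k.bind f)

/-- Makes learning followed by one decision of the learnt policy a single program, to which the
counting bound applies. -/
theorem run_bind (M : MDP n H) (p : IProg S X α) (f : α → IProg S X β) :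
    ∀ σ, (p.bind f).run M σ = (p.run M σ).bind fun o => (f o.1).run M o.2 := by
  induction p with
  | ret x => intro σ; simp [bind, run]
  | envStart F k ih => intro σ; simp [bind, run, ih, PMF.bind_bind]
  | envStep ptr a g F k ih =>
    intro σ
    simp only [bind, run]
    split
    · exact ih _ _
    · split_ifs
      · simp [ih, PMF.bind_bind]
      · exact ih _ _
  | envEvaluate s F k ih => intro σ; simp [bind, run, ih]
  | envEncode s k ih => intro σ; simp [bind, run, ih]
  | envReset k ih => intro σ; simp [bind, run, ih]

/-- Used to see that the remaining budget is positive as long as a call is still to be made. -/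
theorem calls_le_of_mem_support (M : MDP n H) (p : IProg S X α) :
    ∀ σ, ∀ o ∈ (p.run M σ).support, σ.calls ≤ o.2.calls := by
  induction p with
  | ret x =>
    intro σ o ho
    simp only [run, PMF.support_pure, Set.mem_singleton_iff] at ho
    simp [ho]
  | envStart F k ih =>
    intro σ o ho
    simp only [run, PMF.mem_support_bind_iff] at ho
    obtain ⟨s, -, ho⟩ := ho
    exact (Nat.le_succ _).trans (ih _ _ _ _ o ho)
  | envStep ptr a g F k ih =>
    intro σ o ho
    simp only [run] at ho
    split at ho
    · exact (Nat.le_succ _).trans (ih _ _ o ho)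
    · split_ifs at ho
      · rw [PMF.mem_support_bind_iff] at ho
        obtain ⟨s, -, ho⟩ := ho
        exact (Nat.le_succ _).trans (ih _ _ o ho)
      · exact (Nat.le_succ _).trans (ih _ _ o ho)
  | envEvaluate s F k ih => intro σ o ho; exact (Nat.le_succ _).trans (ih _ _ o ho)
  | envEncode s k ih => intro σ o ho; exact (Nat.le_succ _).trans (ih _ _ o ho)
  | envReset k ih => intro σ o ho; exact (Nat.le_succ _).trans (ih _ o ho)

end IProg

/-! ### Symmetric functions do not distinguish the final states of the right branch -/

section swap

variable {m : ℕ}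

/-- Exchange the coordinates `s^{u,i}` and `s^{d,i}` for the `i` that are marked by `c`. -/
def swapIdx (c : Fin m → Bool) (j : Fin (3 * m + 1)) : Fin (3 * m + 1) :=
  if h : m ≤ j.1 ∧ j.1 < 3 * m then
    if c ⟨(j.1 - m) / 2, by omega⟩ then
      if h2 : (j.1 - m) % 2 = 0 then ⟨j.1 + 1, by omega⟩ else ⟨j.1 - 1, by omega⟩
    else j
  else j

theorem swapIdx_involutive (c : Fin m → Bool) : Function.Involutive (swapIdx c) := by
  intro j
  by_cases h : m ≤ j.1 ∧ j.1 < 3 * m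
  · by_cases hc : c ⟨(j.1 - m) / 2, by omega⟩ = true
    · by_cases h2 : (j.1 - m) % 2 = 0
      · have e : swapIdx c j = ⟨j.1 + 1, by omega⟩ := by simp [swapIdx, h, hc, h2]
        have hc' : c ⟨(j.1 + 1 - m) / 2, by omega⟩ = true := by
          rw [← hc]; congr 2; omega
        rw [e, swapIdx, dif_pos ⟨by simp only; omega, by simp only; omega⟩, if_pos hc',
          dif_neg (by simp only; omega)]
        rfl
      · have e : swapIdx c j = ⟨j.1 - 1, by omega⟩ := by simp [swapIdx, h, hc, h2]
        have hc' : c ⟨(j.1 - 1 - m) / 2, by omega⟩ = true := by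
          rw [← hc]; congr 2; omega
        rw [e, swapIdx, dif_pos ⟨by simp only; omega, by simp only; omega⟩, if_pos hc',
          dif_pos (by simp only; omega)]
        ext; simp only; omega
    · have e : swapIdx c j = j := by simp [swapIdx, hc]
      rw [e, e]
  · have e : swapIdx c j = j := by simp [swapIdx, h]
    rw [e, e]

/-- The permutation of the coordinates given by `swapIdx`. -/
def swapPerm (c : Fin m → Bool) : Equiv.Perm (Fin (3 * m + 1)) := (swapIdx_involutive c).toPerm

theorem permState_swapPerm (c : Fin m → Bool) (t : ℕ) (x : Fin (3 * m + 1) → ℝ) :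
    permState (swapPerm c) (t, x) = (t, fun j => x (swapIdx c j)) := rfl

theorem rightVec_swapIdx (c w : Fin m → Bool) : (fun j => rightVec w (swapIdx c j)) = rightVec w := by
  funext j
  by_cases h : m ≤ j.1 ∧ j.1 < 3 * m
  · by_cases hc : c ⟨(j.1 - m) / 2, by omega⟩ = true
    · by_cases h2 : (j.1 - m) % 2 = 0
      · have e : swapIdx c j = ⟨j.1 + 1, by omega⟩ := by simp [swapIdx, h, hc, h2]
        simp [e, rightVec, mkVec, show ¬ j.1 < m by omega, show ¬ j.1 + 1 < m by omega, h.2,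
          show j.1 + 1 < 3 * m by omega]
      · have e : swapIdx c j = ⟨j.1 - 1, by omega⟩ := by simp [swapIdx, h, hc, h2]
        simp [e, rightVec, mkVec, show ¬ j.1 < m by omega, show ¬ j.1 - 1 < m by omega, h.2,
          show j.1 - 1 < 3 * m by omega]
    · simp [swapIdx, hc]
  · simp [swapIdx, h]

/-- The d part is the complement of the u part, so exchanging the two coordinates at i negates the
bit i. -/
theorem endVec_swapIdx (c w : Fin m → Bool) :
    (fun j => endVec w (swapIdx c j)) = endVec fun i => w i ^^ c i := by
  funext j
  by_cases h : m ≤ j.1 ∧ j.1 < 3 * m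
  · have hj : ¬ j.1 < m := by omega
    by_cases hc : c ⟨(j.1 - m) / 2, by omega⟩ = true
    · by_cases h2 : (j.1 - m) % 2 = 0
      · have e : swapIdx c j = ⟨j.1 + 1, by omega⟩ := by simp [swapIdx, h, hc, h2]
        have e2 : (j.1 + 1 - m) / 2 = (j.1 - m) / 2 := by omega
        simp [e, endVec, mkVec, hj, show ¬ j.1 + 1 < m by omega, h.2,
          show j.1 + 1 < 3 * m by omega, h2, show ¬ (j.1 + 1 - m) % 2 = 0 by omega, e2, hc]
      · have e : swapIdx c j = ⟨j.1 - 1, by omega⟩ := by simp [swapIdx, h, hc, h2]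
        have e2 : (j.1 - 1 - m) / 2 = (j.1 - m) / 2 := by omega
        simp [e, endVec, mkVec, hj, show ¬ j.1 - 1 < m by omega, h.2,
          show j.1 - 1 < 3 * m by omega, h2, show (j.1 - 1 - m) % 2 = 0 by omega, e2, hc]
    · simp [swapIdx, hc, endVec, mkVec, hj, h.2]
  · have e : swapIdx c j = j := by simp [swapIdx, h]
    by_cases hj : j.1 < m
    · simp [e, endVec, mkVec, hj]
    · simp [e, endVec, mkVec, hj, show ¬ j.1 < 3 * m by omega]

/-- Before the end all u- and d-coordinates vanish, so exchanging them changes nothing. -/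
theorem permState_swapPerm_of_lt (c : Fin m → Bool) {s : MState (3 * m + 1)}
    (hs : s ∈ familyStates m) (ht : s.1 < m + 2) : permState (swapPerm c) s = s := by
  obtain ⟨t, x⟩ := s
  rw [permState_swapPerm]
  rcases hs with (⟨-, hx⟩ | ⟨-, -, w, -, hx⟩) | ⟨h, -⟩
  · simp only at hx
    subst hx
    rfl
  · simp only at hx
    subst hx
    rw [rightVec_swapIdx]
  · exact absurd h ht.ne

theorem endVec_mem_familyStates (w : Fin m → Bool) : (m + 2, endVec w) ∈ familyStates m :=
  Or.inr ⟨rfl, w, rfl⟩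

/-- Exchanging the pairs where w is false maps `endVec w` to the all-true end vector and fixes the
non-final states in the dataset, so symmetry equates the two values. The restriction to non-final
entries is essential: a stored end vector could be moved. -/
theorem SymFun.apply_endVec {X : Type u} (f : SymFun (familyStates m) X) (w : Fin m → Bool)
    (D : List (MState (3 * m + 1) × X)) (hD : ∀ e ∈ D, e.1 ∈ familyStates m ∧ e.1.1 < m + 2) :
    f.toFun (m + 2, endVec w) D = f.toFun (m + 2, endVec fun _ => true) D := by
  have h1 : permState (swapPerm fun i => !w i) (m + 2, endVec w) =
      (m + 2, endVec fun _ => true) := by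
    rw [permState_swapPerm, endVec_swapIdx]
    simp
  have h2 : (D.map fun e => (permState (swapPerm fun i => !w i) e.1, e.2)) = D := by
    refine (List.map_congr_left fun e he => ?_).trans (List.map_id D)
    rw [permState_swapPerm_of_lt _ (hD e he).1 (hD e he).2]
    rfl
  have h3 := f.symm (swapPerm fun i => !w i) (m + 2, endVec w) D (endVec_mem_familyStates w)
    (by rw [h1]; exact endVec_mem_familyStates _)
    (fun e he => ⟨(hD e he).1, by
      rw [permState_swapPerm_of_lt _ (hD e he).1 (hD e he).2]; exact (hD e he).1⟩)
  rw [h1, h2] at h3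
  exact h3.symm

end swap

/-! ### Few calls reveal little about the hidden word -/

section hidden

variable {m : ℕ}

/-- What matters of a stored state: final states can only be answered by `⊥`. -/
def visible (H : ℕ) {n : ℕ} (s : MState n) : Option (MState n) := if s.1 < H then some s else none

/-- Only the last step of the right branch depends on the hidden word. -/
theorem familyStep_cases {s : MState (3 * m + 1)} (hs : s ∈ familyStates m) (ht : s.1 < m + 2) :
    (∃ w, s = (m + 1, rightVec w)) ∨ ∀ b b' a, familyStep m b s a = familyStep m b' s a := by
  obtain ⟨t, x⟩ := s
  by_cases h : t = m + 1 ∧ cPart x ≠ 0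
  · left
    rcases hs with (⟨-, hx⟩ | ⟨-, -, w, -, hx⟩) | ⟨h', -⟩
    · simp only at hx
      subst hx
      exact absurd cPart_zero h.2
    · exact ⟨w, Prod.ext h.1 hx⟩
    · exact absurd h' ht.ne
  · right
    intro b b' a
    unfold familyStep
    by_cases h0 : t = m + 1
    · have hc : cPart x = 0 := by
        by_contra hc
        exact h ⟨h0, hc⟩
      simp [h0, hc]
    · simp [h0]

variable {X : Type u} {α : Type*} (φ : (Fin m → Bool) → α → ENNReal) (C : ENNReal)

/-- If the memories agree up to the identity of the final states, and at most `K` further calls are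
made for each hidden word of `B`, then the sum over `B` of the expectations of `φ b` exceeds the
pointwise bound by at most `K`. -/
theorem sum_pexp_run_le (hφ : ∀ b x, φ b x ≤ 1) (hC : ∀ x, ∑ b, φ b x ≤ C)
    (p : IProg (familyStates m) X α) :
    ∀ (B : Finset (Fin m → Bool)) (V : List (Option (MState (3 * m + 1))))
      (ptrs : (Fin m → Bool) → List (MState (3 * m + 1)))
      (D : List (MState (3 * m + 1) × X)) (c K : ℕ),
      (∀ b ∈ B, (ptrs b).map (visible (m + 2)) = V) →
      (∀ s, some s ∈ V → s ∈ familyStates m) →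
      (∀ e ∈ D, e.1 ∈ familyStates m ∧ e.1.1 < m + 2) →
      (∀ b ∈ B, ∀ o ∈ (p.run (familyMDP m b) ⟨ptrs b, D, c⟩).support, o.2.calls ≤ c + K) →
      ∑ b ∈ B, pexp (p.run (familyMDP m b) ⟨ptrs b, D, c⟩) (fun o => φ b o.1) ≤ C + K := by
  classical
  have hlen : ∀ {B : Finset (Fin m → Bool)} {V : List (Option (MState (3 * m + 1)))}
      {ptrs : (Fin m → Bool) → List (MState (3 * m + 1))},
      (∀ b ∈ B, (ptrs b).map (visible (m + 2)) = V) → ∀ b ∈ B, (ptrs b).length = V.length := by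
    intro B V ptrs h b hb
    rw [← h b hb, List.length_map]
  have happ : ∀ {B : Finset (Fin m → Bool)} {V : List (Option (MState (3 * m + 1)))}
      {ptrs : (Fin m → Bool) → List (MState (3 * m + 1))} (s : MState (3 * m + 1)),
      (∀ b ∈ B, (ptrs b).map (visible (m + 2)) = V) →
      ∀ b ∈ B, (ptrs b ++ [s]).map (visible (m + 2)) = V ++ [visible (m + 2) s] := by
    intro B V ptrs s h b hb
    rw [List.map_append, h b hb]
    rfl
  have hmem : ∀ {V : List (Option (MState (3 * m + 1)))} {s' : MState (3 * m + 1)},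
      (∀ s, some s ∈ V → s ∈ familyStates m) → s' ∈ familyStates m →
      ∀ s, some s ∈ V ++ [visible (m + 2) s'] → s ∈ familyStates m := by
    intro V s' hV hs' s hs
    rw [List.mem_append, List.mem_singleton] at hs
    rcases hs with hs | hs
    · exact hV s hs
    · rw [visible] at hs
      split_ifs at hs
      exact (Option.some.inj hs) ▸ hs'
  -- Here B is the set of words not yet singled out. For all of them the dataset and the visible
  -- part V of the memory coincide, so the program receives the same answers as long as no last
  -- right-branch step hits its word.
  induction p with
  | ret x =>
    intro B V ptrs D c K _ _ _ _
    simp only [IProg.run, pexp_pure]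
    exact (Finset.sum_le_univ_sum_of_nonneg fun _ => zero_le).trans
      ((hC x).trans le_self_add)
  | envStart F k ih =>
    intro B V ptrs D c K hV hVS hD hK
    rcases B.eq_empty_or_nonempty with rfl | ⟨b₀, hb₀⟩
    · simp
    have hrun : ∀ b ∈ B, (IProg.envStart F k).run (familyMDP m b) ⟨ptrs b, D, c⟩ =
        (k (0, 0) V.length fun i => (F i).toFun (0, 0) D).run (familyMDP m b)
          ⟨ptrs b ++ [(0, 0)], D, c + 1⟩ := by
      intro b hb
      simp [IProg.run, familyMDP, hlen hV b hb]
    -- Some outcome exists and its counter already includes this call, so the budget K is at least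
    -- 1. The same argument recurs for each kind of call.
    obtain ⟨o, ho⟩ := ((IProg.envStart F k).run (familyMDP m b₀) ⟨ptrs b₀, D, c⟩).support_nonempty
    have h1 := hK b₀ hb₀ o ho
    rw [hrun b₀ hb₀] at ho
    have h2 := IProg.calls_le_of_mem_support _ _ _ o ho
    obtain ⟨K, rfl⟩ : ∃ K', K = K' + 1 := ⟨K - 1, by simp only at h2; omega⟩
    rw [Finset.sum_congr rfl fun b hb => by rw [hrun b hb]]
    refine (ih _ _ _ B _ (fun b => ptrs b ++ [(0, 0)]) D (c + 1) K (happ _ hV)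
      (hmem hVS (Or.inl (Or.inl ⟨Nat.zero_le _, rfl⟩))) hD fun b hb o ho => ?_).trans ?_
    · have := hK b hb o (by rw [hrun b hb]; exact ho)
      omega
    · gcongr; simp
  | envStep ptr a g F k ih =>
    intro B V ptrs D c K hV hVS hD hK
    rcases B.eq_empty_or_nonempty with rfl | ⟨b₀, hb₀⟩
    · simp
    have hget : ∀ b ∈ B, ((ptrs b)[ptr]?).map (visible (m + 2)) = V[ptr]? := by
      intro b hb
      rw [← hV b hb, List.getElem?_map]
    obtain ⟨K, rfl⟩ : ∃ K', K = K' + 1 := by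
      obtain ⟨o, ho⟩ :=
        ((IProg.envStep ptr a g F k).run (familyMDP m b₀) ⟨ptrs b₀, D, c⟩).support_nonempty
      have h1 := hK b₀ hb₀ o ho
      have h2 : c + 1 ≤ o.2.calls := by
        simp only [IProg.run] at ho
        split at ho
        · exact IProg.calls_le_of_mem_support _ _ _ o ho
        · split_ifs at ho
          · rw [PMF.mem_support_bind_iff] at ho
            obtain ⟨s, -, ho⟩ := ho
            exact IProg.calls_le_of_mem_support _ _ _ o ho
          · exact IProg.calls_le_of_mem_support _ _ _ o ho
      exact ⟨K - 1, by omega⟩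
    have hnone : (∀ b ∈ B, (IProg.envStep ptr a g F k).run (familyMDP m b) ⟨ptrs b, D, c⟩ =
        (k none).run (familyMDP m b) ⟨ptrs b, D, c + 1⟩) →
        ∑ b ∈ B, pexp ((IProg.envStep ptr a g F k).run (familyMDP m b) ⟨ptrs b, D, c⟩)
          (fun o => φ b o.1) ≤ C + (K + 1 : ℕ) := by
      intro hrun
      rw [Finset.sum_congr rfl fun b hb => by rw [hrun b hb]]
      refine (ih _ B _ ptrs D (c + 1) K hV hVS hD fun b hb o ho => ?_).trans ?_
      · have := hK b hb o (by rw [hrun b hb]; exact ho)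
        omega
      · gcongr; simp
    -- Three cases: no such pointer, a final state, or a non-final state common to all words of B.
    -- The first two are answered by ⊥ whatever the word.
    rcases hP : V[ptr]? with _ | _ | s
    · refine hnone fun b hb => ?_
      have h := hget b hb
      rw [hP, Option.map_eq_none_iff] at h
      simp [IProg.run, h]
    · refine hnone fun b hb => ?_
      have h := hget b hb
      rw [hP, Option.map_eq_some_iff] at h
      obtain ⟨s, hs, hv⟩ := h
      have hs' : ¬ s.1 < m + 2 := by
        intro h
        simp [visible, h] at hv
      simp [IProg.run, hs, hs']
    · have hsS : s ∈ familyStates m := hVS s (List.mem_of_getElem? hP)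
      have hget' : ∀ b ∈ B, (ptrs b)[ptr]? = some s ∧ s.1 < m + 2 := by
        intro b hb
        have h := hget b hb
        rw [hP, Option.map_eq_some_iff] at h
        obtain ⟨s', hs, hv⟩ := h
        rw [visible] at hv
        split_ifs at hv with hlt
        obtain rfl := Option.some.inj hv
        exact ⟨hs, hlt⟩
      have hst : s.1 < m + 2 := (hget' b₀ hb₀).2
      have hD' : ∀ x, ∀ e ∈ D ++ [(s, x)], e.1 ∈ familyStates m ∧ e.1.1 < m + 2 := by
        intro x e he
        rw [List.mem_append, List.mem_singleton] at he
        rcases he with he | rfl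
        · exact hD e he
        · exact ⟨hsS, hst⟩
      have hrun : ∀ b ∈ B, (IProg.envStep ptr a g F k).run (familyMDP m b) ⟨ptrs b, D, c⟩ =
          (familyStep m b s a).bind fun o =>
            (k (some (s, a, o.1, V.length, fun i => (F i).toFun o.2 D))).run (familyMDP m b)
              ⟨ptrs b ++ [o.2], D ++ [(s, g a o.1 fun i => (F i).toFun o.2 D)], c + 1⟩ := by
        intro b hb
        simp only [IProg.run, (hget' b hb).1, hst, if_true, hlen hV b hb]
        rfl
      rcases familyStep_cases hsS hst with ⟨w, rfl⟩ | hind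
      -- The informative call, with recorded word w. For every b ≠ w the reward is 0 and the
      -- symmetric functions return the common v; the end vectors differ with b, but as final states
      -- they enter V only as `none`.
      · set v : Fin _ → ℝ := fun i => (F i).toFun (m + 2, endVec fun _ => true) D with hv
        have hrun' : ∀ b ∈ B.erase w,
            (IProg.envStep ptr a g F k).run (familyMDP m b) ⟨ptrs b, D, c⟩ =
            (k (some ((m + 1, rightVec w), a, 0, V.length, v))).run (familyMDP m b)
              ⟨ptrs b ++ [(m + 2, endVec fun i => w i == b i)],
                D ++ [((m + 1, rightVec w), g a 0 v)], c + 1⟩ := by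
          intro b hb
          rw [hrun b (Finset.mem_of_mem_erase hb), familyStep_right_last, PMF.pure_bind,
            if_neg (Finset.ne_of_mem_erase hb).symm]
          simp only [SymFun.apply_endVec _ _ D hD, hv]
        -- Dropping w from B loses at most 1 from the sum, which is paid for by this call.
        have hsplit : ∀ y : (Fin m → Bool) → ENNReal, (∀ b, y b ≤ 1) →
            ∑ b ∈ B, y b ≤ ∑ b ∈ B.erase w, y b + 1 := by
          intro y hy
          by_cases hw : w ∈ B
          · rw [← Finset.sum_erase_add _ _ hw]
            gcongr
            exact hy w
          · rw [Finset.erase_eq_of_notMem hw]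
            exact le_self_add
        refine (hsplit _ fun b => pexp_le fun o _ => hφ b o.1).trans ?_
        rw [Finset.sum_congr rfl fun b hb => by rw [hrun' b hb]]
        have := ih (some ((m + 1, rightVec w), a, 0, V.length, v)) (B.erase w) (V ++ [none])
          (fun b => ptrs b ++ [(m + 2, endVec fun i => w i == b i)])
          (D ++ [((m + 1, rightVec w), g a 0 v)]) (c + 1) K
          (fun b hb => by
            rw [List.map_append, hV b (Finset.mem_of_mem_erase hb)]
            simp [visible])
          (fun s hs => by
            rw [List.mem_append, List.mem_singleton] at hs
            rcases hs with hs | hs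
            · exact hVS s hs
            · cases hs)
          (hD' _)
          (fun b hb o ho => by
            have := hK b (Finset.mem_of_mem_erase hb) o (by rw [hrun' b hb]; exact ho)
            omega)
        rw [Nat.cast_add, Nat.cast_one, ← add_assoc]
        gcongr
      -- The transition does not depend on the word, so one outcome can be drawn for all b together
      -- and the sum moves inside the expectation.
      · have hrun' : ∀ b ∈ B, (IProg.envStep ptr a g F k).run (familyMDP m b) ⟨ptrs b, D, c⟩ =
            (familyStep m b₀ s a).bind fun o =>
              (k (some (s, a, o.1, V.length, fun i => (F i).toFun o.2 D))).run (familyMDP m b)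
                ⟨ptrs b ++ [o.2], D ++ [(s, g a o.1 fun i => (F i).toFun o.2 D)], c + 1⟩ := by
          intro b hb
          rw [hrun b hb, hind b b₀ a]
        rw [Finset.sum_congr rfl fun b hb => by rw [hrun' b hb, pexp_bind], ← pexp_sum]
        refine pexp_le fun o ho => ?_
        refine (ih _ B _ (fun b => ptrs b ++ [o.2]) _ (c + 1) K (happ _ hV)
          (hmem hVS ((familyMDP m b₀).step_mem s hsS hst a o ho).1) (hD' _)
          fun b hb o' ho' => ?_).trans ?_
        · have := hK b hb o' (by
            rw [hrun' b hb, PMF.mem_support_bind_iff]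
            exact ⟨o, ho, ho'⟩)
          omega
        · gcongr; simp
  | envEvaluate s F k ih =>
    intro B V ptrs D c K hV hVS hD hK
    rcases B.eq_empty_or_nonempty with rfl | ⟨b₀, hb₀⟩
    · simp
    obtain ⟨o, ho⟩ :=
      ((IProg.envEvaluate s F k).run (familyMDP m b₀) ⟨ptrs b₀, D, c⟩).support_nonempty
    have h1 := hK b₀ hb₀ o ho
    have h2 : c + 1 ≤ o.2.calls :=
      IProg.calls_le_of_mem_support _ (k fun i => (F i).toFun s.1 D) ⟨ptrs b₀, D, c + 1⟩ o ho
    obtain ⟨K, rfl⟩ : ∃ K', K = K' + 1 := ⟨K - 1, by omega⟩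
    refine (ih (fun i => (F i).toFun s.1 D) B V ptrs D (c + 1) K hV hVS hD
      fun b hb o ho => ?_).trans ?_
    · have := hK b hb o ho
      omega
    · gcongr; simp
  | envEncode s k ih =>
    intro B V ptrs D c K hV hVS hD hK
    rcases B.eq_empty_or_nonempty with rfl | ⟨b₀, hb₀⟩
    · simp
    have hrun : ∀ b ∈ B, (IProg.envEncode s k).run (familyMDP m b) ⟨ptrs b, D, c⟩ =
        (k V.length).run (familyMDP m b) ⟨ptrs b ++ [s.1], D, c + 1⟩ := by
      intro b hb
      simp [IProg.run, hlen hV b hb]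
    obtain ⟨o, ho⟩ := ((IProg.envEncode s k).run (familyMDP m b₀) ⟨ptrs b₀, D, c⟩).support_nonempty
    have h1 := hK b₀ hb₀ o ho
    have h2 : c + 1 ≤ o.2.calls :=
      IProg.calls_le_of_mem_support _ (k (ptrs b₀).length) ⟨ptrs b₀ ++ [s.1], D, c + 1⟩ o ho
    obtain ⟨K, rfl⟩ : ∃ K', K = K' + 1 := ⟨K - 1, by omega⟩
    rw [Finset.sum_congr rfl fun b hb => by rw [hrun b hb]]
    refine (ih _ B _ (fun b => ptrs b ++ [s.1]) D (c + 1) K (happ _ hV)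
      (hmem hVS s.2) hD fun b hb o ho => ?_).trans ?_
    · have := hK b hb o (by rw [hrun b hb]; exact ho)
      omega
    · gcongr; simp
  | envReset k ih =>
    intro B V ptrs D c K hV hVS hD hK
    rcases B.eq_empty_or_nonempty with rfl | ⟨b₀, hb₀⟩
    · simp
    obtain ⟨o, ho⟩ := ((IProg.envReset k).run (familyMDP m b₀) ⟨ptrs b₀, D, c⟩).support_nonempty
    have h1 := hK b₀ hb₀ o ho
    have h2 : c + 1 ≤ o.2.calls :=
      IProg.calls_le_of_mem_support _ k ⟨ptrs b₀, [], c + 1⟩ o ho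
    obtain ⟨K, rfl⟩ : ∃ K', K = K' + 1 := ⟨K - 1, by omega⟩
    refine (ih B V ptrs [] (c + 1) K hV hVS (by simp) fun b hb o ho => ?_).trans ?_
    · have := hK b hb o ho
      omega
    · gcongr; simp

/-! ### Averaging over the hidden words -/

/-- Flipping the first bit pairs the words so that the two probabilities in each pair add up to 1:
without information every action law is right on half of the words. -/
theorem sum_first_bit (hm : 0 < m) (x : PMF Bool) :
    ∑ b : Fin m → Bool, x (b ⟨0, hm⟩) = 2 ^ m / 2 := by
  classical
  have hinv : Function.Involutive fun b : Fin m → Bool => Function.update b ⟨0, hm⟩ !b ⟨0, hm⟩ := by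
    intro b; simp
  have h1 : ∑ b : Fin m → Bool, x (b ⟨0, hm⟩) = ∑ b : Fin m → Bool, x (!b ⟨0, hm⟩) := by
    rw [← Equiv.sum_comp hinv.toPerm]
    simp
  have h2 : ∀ c : Bool, x c + x (!c) = 1 := by
    have := x.tsum_coe
    rw [tsum_fintype, Fintype.sum_bool] at this
    intro c
    cases c
    · rw [add_comm]; exact this
    · exact this
  have h3 : 2 * ∑ b : Fin m → Bool, x (b ⟨0, hm⟩) = 2 ^ m := by
    rw [two_mul]
    nth_rewrite 2 [h1]
    rw [← Finset.sum_add_distrib, Finset.sum_congr rfl fun b _ => h2 _]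
    simp
  rw [← h3, mul_comm, ENNReal.mul_div_cancel_right (by simp) (by simp)]

/-- For almost every seed, the failure probabilities add up to almost half of the number of words. -/
theorem two_pow_le_sum_failProb (hm : 0 < m) (A : IAlg.{u, v} (familyStates m)) (K : ℕ)
    (hK : ∀ b, A.CallsLe (familyMDP m b) K) :
    ∀ᵐ ω ∂A.seedLaw,
      (2 : ENNReal) ^ m ≤ 2 ^ m / 2 + K + ∑ b, A.failProb (familyMDP m b) ω := by
  have hall : ∀ᵐ ω ∂A.seedLaw, ∀ b : Fin m → Bool, ∀ s ∈ familyStates m,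
      ∀ o ∈ ((A.learn ω).run (familyMDP m b) (EnvState.empty _ A.X)).support,
        ∀ o' ∈ ((o.1 s).run (familyMDP m b) o.2).support, o'.2.calls ≤ K :=
    eventually_countable_forall.2 hK
  filter_upwards [hall] with ω hω
  set s₁ : MState (3 * m + 1) := (1, rightVec fun _ => false) with hs₁
  have hs₁S : s₁ ∈ familyStates m := Or.inl (Or.inr ⟨le_rfl, by simp [s₁], fun _ => false, by simp, rfl⟩)
  set J : IProg (familyStates m) A.X (PMF Bool) := (A.learn ω).bind fun π => π s₁
  have hJ : ∀ b, (1 : ENNReal) ≤ pexp (J.run (familyMDP m b) (EnvState.empty _ A.X))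
      (fun o => o.1 (b ⟨0, hm⟩)) + A.failProb (familyMDP m b) ω := by
    intro b
    -- Split 1 into success and failure. On success the first bit is played with probability 1, so
    -- the success probability is at most the expected score.
    rw [← toOuterMeasure_add_compl ((A.learn ω).run (familyMDP m b) (EnvState.empty _ A.X))
      {o | (familyMDP m b).IsOptimal (o.1.toPolicy (familyMDP m b) o.2)}]
    refine add_le_add ?_ le_rfl
    rw [toOuterMeasure_eq_pexp, IProg.run_bind, pexp_bind]
    refine pexp_mono fun o _ => ?_
    by_cases ho : (familyMDP m b).IsOptimal (o.1.toPolicy (familyMDP m b) o.2)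
    · have := family_first_of_isOptimal b _ hm ho
      rw [Set.indicator_of_mem (by exact ho), Pi.one_apply, ← this, IPolicy.toPolicy, PMF.bind_apply]
      rfl
    · rw [Set.indicator_of_notMem (by exact ho)]
      exact zero_le
  have hsum := sum_pexp_run_le (fun b (x : PMF Bool) => x (b ⟨0, hm⟩)) (2 ^ m / 2)
    (fun b x => x.coe_le_one _) (fun x => (sum_first_bit hm x).le) J Finset.univ []
    (fun _ => []) [] 0 K (by simp) (by simp) (by simp) (fun b _ o ho => by
      rw [IProg.run_bind, PMF.mem_support_bind_iff] at ho
      obtain ⟨o', ho', ho⟩ := ho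
      rw [zero_add]
      exact hω b s₁ hs₁S o' ho' o ho)
  calc (2 : ENNReal) ^ m = ∑ _b : Fin m → Bool, (1 : ENNReal) := by simp
    _ ≤ _ := Finset.sum_le_sum fun b _ => hJ b
    _ ≤ _ := by
      rw [Finset.sum_add_distrib]
      gcongr
      exact hsum

theorem exists_failProb_ge (hm : 0 < m) (A : IAlg.{u, v} (familyStates m)) (K : ℕ)
    (hK : ∀ b, A.CallsLe (familyMDP m b) K)
    (hA : ∀ b, AEMeasurable (A.failProb (familyMDP m b)) A.seedLaw) (hlt : 8 * K ≤ 2 ^ m) :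
    ∃ b, (1 / 3 : ENNReal) ≤ ∫⁻ ω, A.failProb (familyMDP m b) ω ∂A.seedLaw := by
  by_contra! hcon
  have := A.prob
  have h1 : (2 : ENNReal) ^ m ≤ 2 ^ m / 2 + K + ∑ b : Fin m → Bool,
      ∫⁻ ω, A.failProb (familyMDP m b) ω ∂A.seedLaw := by
    rw [← lintegral_finsetSum' _ fun b _ => hA b]
    calc (2 : ENNReal) ^ m = ∫⁻ _, 2 ^ m ∂A.seedLaw := by simp
      _ ≤ ∫⁻ ω, (2 ^ m / 2 + K + ∑ b, A.failProb (familyMDP m b) ω) ∂A.seedLaw :=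
        lintegral_mono_ae (two_pow_le_sum_failProb hm A K hK)
      _ = _ := by
        rw [lintegral_add_left measurable_const]
        simp
  have h2 : ∑ b : Fin m → Bool, ∫⁻ ω, A.failProb (familyMDP m b) ω ∂A.seedLaw ≤
      2 ^ m * (1 / 3) := by
    refine (Finset.sum_le_sum fun b _ => (hcon b).le).trans ?_
    simp
  have h3 : (2 : ENNReal) ^ m ≤ 2 ^ m / 2 + K + 2 ^ m * (1 / 3) := h1.trans (by gcongr)
  have h4 := ENNReal.toReal_mono (by finiteness) h3
  rw [ENNReal.toReal_add (by finiteness) (by finiteness),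
    ENNReal.toReal_add (by finiteness) (by finiteness)] at h4
  simp only [ENNReal.toReal_pow, ENNReal.toReal_ofNat, ENNReal.toReal_div, ENNReal.toReal_natCast,
    ENNReal.toReal_mul, ENNReal.toReal_one] at h4
  -- The contradiction is 1/2 + 1/8 + 1/3 = 23/24 < 1.
  have h5 : (8 * K : ℝ) ≤ 2 ^ m := by exact_mod_cast hlt
  have h6 : (0 : ℝ) < 2 ^ m := by positivity
  linarith

end hidden

theorem interface_lower_bound (A : (m : ℕ) → IAlg.{u, v} (familyStates m)) (K : ℕ → ℕ)
    (hKo : (fun H : ℕ => (K H : ℝ)) =o[atTop] (fun H : ℕ => (2 : ℝ) ^ H))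
    (hK : ∀ (m : ℕ) (b : Fin m → Bool), (A m).CallsLe (familyMDP m b) (K (m + 2)))
    (hA : ∀ (m : ℕ) (b : Fin m → Bool),
      AEMeasurable ((A m).failProb (familyMDP m b)) (A m).seedLaw) :
    ∀ᶠ m : ℕ in atTop, ∃ b : Fin m → Bool,
      (1 / 3 : ENNReal) ≤ ∫⁻ ω, (A m).failProb (familyMDP m b) ω ∂(A m).seedLaw := by
  -- Since 2^H = 4 · 2^m, the constant 1/32 gives 8 K ≤ 2^m.
  have h := (tendsto_add_atTop_nat 2).eventually (hKo.bound (show (0 : ℝ) < 1 / 32 by norm_num))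
  filter_upwards [h, eventually_gt_atTop 0] with m hm h0
  refine exists_failProb_ge h0 (A m) (K (m + 2)) (hK m) (hA m) ?_
  rw [Real.norm_natCast, norm_pow, Real.norm_ofNat, pow_add] at hm
  have : (8 * K (m + 2) : ℝ) ≤ 2 ^ m := by linarith
  exact_mod_cast this

/-! ### Uniform and independent draws -/

section draws

variable {α β : Type*}

theorem pexp_comm (p : PMF α) (q : PMF β) (f : α → β → ENNReal) :
    pexp p (fun a => pexp q fun b => f a b) = pexp q fun b => pexp p fun a => f a b := by
  simp only [pexp, ← ENNReal.tsum_mul_left]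
  rw [ENNReal.tsum_comm]
  exact tsum_congr fun b => tsum_congr fun a => by ring

theorem pexp_uniform_prod [Fintype α] [Nonempty α] [Fintype β] [Nonempty β]
    (f : α × β → ENNReal) :
    pexp (PMF.uniformOfFintype (α × β)) f =
      pexp (PMF.uniformOfFintype α) fun a => pexp (PMF.uniformOfFintype β) fun b => f (a, b) := by
  simp only [pexp_uniform, Fintype.sum_prod_type, Fintype.card_prod, Nat.cast_mul]
  rw [← Finset.mul_sum, ← mul_assoc, ENNReal.mul_inv (by simp) (by simp)]

theorem pexp_uniform_equiv [Fintype α] [Nonempty α] [Fintype β] [Nonempty β] (e : α ≃ β)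
    (f : β → ENNReal) :
    pexp (PMF.uniformOfFintype β) f = pexp (PMF.uniformOfFintype α) fun a => f (e a) := by
  simp only [pexp_uniform, Fintype.card_congr e, Equiv.sum_comp e f]

theorem pexp_uniform_cons (k : ℕ) (f : (Fin (k + 1) → Bool) → ENNReal) :
    pexp (PMF.uniformOfFintype (Fin (k + 1) → Bool)) f =
      pexp (PMF.uniformOfFintype Bool) fun a =>
        pexp (PMF.uniformOfFintype (Fin k → Bool)) fun c => f (Fin.cons a c) := by
  rw [pexp_uniform_equiv (Fin.consEquiv fun _ => Bool), pexp_uniform_prod]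
  rfl

theorem pexp_iidLaw_prod (p : PMF β) (f : β → ENNReal) (N : ℕ) :
    pexp (iidLaw p N) (fun D => ∏ i, f (D i)) = pexp p f ^ N := by
  induction N with
  | zero => simp [iidLaw, pexp_pure]
  | succ N ih =>
    simp only [iidLaw, pexp_bind, pexp_map, Fin.prod_univ_succ, Fin.cons_zero, Fin.cons_succ,
      pexp_const_mul, ih]
    simp only [mul_comm _ (pexp p f ^ N), pexp_const_mul, pow_succ]

theorem mem_support_of_mem_iidLaw (p : PMF β) (N : ℕ) :
    ∀ D ∈ (iidLaw p N).support, ∀ i, D i ∈ p.support := by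
  induction N with
  | zero => intro D _ i; exact i.elim0
  | succ N ih =>
    intro D hD i
    simp only [iidLaw, PMF.mem_support_bind_iff, PMF.mem_support_map_iff] at hD
    obtain ⟨x, hx, D', hD', rfl⟩ := hD
    refine Fin.cases ?_ (fun i => ?_) i
    · exact hx
    · exact ih D' hD' i

open Classical in
/-- Chernoff bound for the event that `E₁` happens at most as often as `E₂`. -/
theorem iidLaw_card_le_card (p : PMF β) (E₁ E₂ : β → Prop) (ρ : ENNReal) (N : ℕ)
    (h : pexp p (fun x => ENNReal.ofReal
      ((if E₂ x then 2 else 1) * (if E₁ x then 1 / 2 else 1))) ≤ ρ) :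
    pexp (iidLaw p N) ({D | (Finset.univ.filter fun i => E₁ (D i)).card ≤
      (Finset.univ.filter fun i => E₂ (D i)).card}.indicator 1) ≤ ρ ^ N := by
  -- The product of the weights is 2 to the number of occurrences of `E₂` minus those of `E₁`. It is
  -- at least 1 on the event, and by independence its expectation factors.
  refine le_trans (pexp_mono fun D _ => ?_) ((pexp_iidLaw_prod p _ N).le.trans (by gcongr))
  by_cases hD : D ∈ {D : Fin N → β | (Finset.univ.filter fun i => E₁ (D i)).card ≤
      (Finset.univ.filter fun i => E₂ (D i)).card}
  · rw [Set.indicator_of_mem hD, Pi.one_apply, ← ENNReal.ofReal_prod_of_nonneg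
      (fun i _ => by positivity), ENNReal.one_le_ofReal, Finset.prod_mul_distrib]
    simp only [Finset.prod_ite, Finset.prod_const, one_pow, mul_one]
    rw [one_div, inv_pow, ← div_eq_mul_inv, one_le_div (by positivity)]
    exact pow_le_pow_right₀ (by norm_num) hD
  · rw [Set.indicator_of_notMem hD]
    exact zero_le

end draws

/-! ### The law of a trajectory under uniformly random actions -/

section law

variable {m : ℕ}

/-- The sequence `a`, with its entries from `t` on replaced by the word `c`. -/
def extendAt (a : ℕ → Bool) (t : ℕ) {k : ℕ} (c : Fin k → Bool) : ℕ → Bool :=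
  fun j => if h : t ≤ j ∧ j < t + k then c ⟨j - t, by omega⟩ else a j

theorem extendAt_cons (a : ℕ → Bool) (t : ℕ) {k : ℕ} (a₀ : Bool) (c : Fin k → Bool) :
    extendAt a t (Fin.cons a₀ c : Fin (k + 1) → Bool) =
      extendAt (Function.update a t a₀) (t + 1) c := by
  funext j
  rcases lt_trichotomy j t with h | rfl | h
  · simp [extendAt, show ¬ t ≤ j by omega, show ¬ t + 1 ≤ j by omega, h.ne]
  · simp [extendAt]
  · by_cases h2 : j < t + (k + 1)
    · have : (⟨j - t, by omega⟩ : Fin (k + 1)) = Fin.succ ⟨j - (t + 1), by omega⟩ := by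
        ext; simp; omega
      rw [extendAt, extendAt, dif_pos ⟨h.le, h2⟩, dif_pos ⟨h, by omega⟩, this, Fin.cons_succ]
    · simp [extendAt, h2, show ¬ j < t + 1 + k by omega, h.ne']

theorem extendAt_of_lt (a : ℕ → Bool) {t j : ℕ} (h : j < t) {k : ℕ} (c : Fin k → Bool) :
    extendAt a t c j = a j := by
  simp [extendAt, show ¬ t ≤ j by omega]

/-- The word of the actions `a` that are recorded before time `t`. -/
def recWord (m : ℕ) (a : ℕ → Bool) (t : ℕ) : Fin m → Bool :=
  fun i => decide (i.1 + 1 < t) && a (i.1 + 1)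

theorem recWord_congr {a a' : ℕ → Bool} {t : ℕ} (h : ∀ j < t, a j = a' j) :
    recWord m a t = recWord m a' t := by
  funext i
  by_cases hi : i.1 + 1 < t
  · simp [recWord, h _ hi]
  · simp [recWord, hi]

variable (b : Fin m → Bool)

/-- The state at time `t`, given the branch, the coin of the left branch and the actions. -/
noncomputable def pathState (r : Bool) (o : Fin 3) (a : ℕ → Bool) (t : ℕ) : MState (3 * m + 1) :=
  (t, if t = 0 then 0
    else if t = m + 2 then
      if r then endVec (fun i => a (i.1 + 1) == b i) else if o = 0 then endVec (fun _ => true) else 0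
    else if r then rightVec (recWord m a t) else 0)

/-- The reward at time `t`, given the branch, the coin of the left branch and the actions. -/
noncomputable def pathRew (r : Bool) (o : Fin 3) (a : ℕ → Bool) (t : ℕ) : ℝ :=
  if t = m + 1 then
    if r then if (fun i : Fin m => a (i.1 + 1)) = b then 1 else 0 else if o = 0 then 1 else 0
  else 0

/-- The segment of length `k`, from time `t` on of an infinite trajectory. -/
def trajSegment {n : ℕ} (st : ℕ → MState n) (rw : ℕ → ℝ) (a : ℕ → Bool) (t k : ℕ) : Traj n k where
  state j := st (t + j)
  act j := a (t + j)
  rew j := rw (t + j)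

theorem trajSegment_succ {n : ℕ} (st : ℕ → MState n) (rw : ℕ → ℝ) (a : ℕ → Bool) (t k : ℕ) :
    trajSegment st rw a t (k + 1) = Traj.cons (st t) (a t) (rw t) (trajSegment st rw a (t + 1) k) := by
  have h : ∀ j, t + (j + 1) = t + 1 + j := fun j => by omega
  unfold trajSegment Traj.cons
  congr 1 <;> funext j <;> refine Fin.cases (by simp) (fun j => ?_) j <;>
    simp only [Fin.cons_succ, Fin.val_succ, ← h]

theorem trajSegment_zero {n : ℕ} (st : ℕ → MState n) (rw : ℕ → ℝ) (a : ℕ → Bool) (t : ℕ) :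
    trajSegment st rw a t 0 = ⟨fun _ => st t, Fin.elim0, Fin.elim0⟩ := by
  unfold trajSegment
  congr 1 <;> funext j
  · simp
  · exact j.elim0
  · exact j.elim0

/-- The coin shows only at time m + 2, and the state at time t has recorded only earlier actions.
Hence later draws may be replaced freely. -/
theorem pathState_congr (r : Bool) (o o' : Fin 3) {a a' : ℕ → Bool} {t : ℕ} (ht : t ≤ m + 1)
    (h : ∀ j < t, a j = a' j) : pathState b r o a t = pathState b r o' a' t := by
  simp [pathState, show t ≠ m + 2 by omega, recWord_congr h]

theorem familyStep_pathState {r : Bool} {o : Fin 3} {a : ℕ → Bool} {t : ℕ} (h1 : 1 ≤ t)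
    (h2 : t ≤ m) (a₀ : Bool) : familyStep m b (pathState b r o a t) a₀ =
      PMF.pure (0, pathState b r o (Function.update a t a₀) (t + 1)) := by
  cases r
  · simp [pathState, show t ≠ 0 by omega, show t ≠ m + 2 by omega, show t ≠ m + 1 by omega,
      familyStep_left b h1 h2]
  · simp only [pathState, show t ≠ 0 by omega, show t ≠ m + 2 by omega, show t + 1 ≠ 0 by omega,
      show t + 1 ≠ m + 2 by omega, if_false, if_true, familyStep_right b h1 h2]
    congr 4
    funext i
    by_cases hi : i.1 + 1 = t
    · simp [recWord, hi]
    · by_cases hi' : i.1 + 1 < t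
      · simp [recWord, hi, hi', show i.1 < t by omega]
      · simp [recWord, hi, hi', show ¬ i.1 < t by omega]

/-- The coin is drawn on the right branch too, where it is ignored; this gives both branches the
same probability space. -/
theorem familyStep_pathState_last {r : Bool} {o : Fin 3} {a : ℕ → Bool} (a₀ : Bool) :
    familyStep m b (pathState b r o a (m + 1)) a₀ = (PMF.uniformOfFintype (Fin 3)).map fun o' =>
      (pathRew b r o' (Function.update a (m + 1) a₀) (m + 1),
        pathState b r o' (Function.update a (m + 1) a₀) (m + 2)) := by
  cases r
  · simp only [pathState, pathRew, show m + 1 ≠ 0 by omega, show m + 1 ≠ m + 2 by omega,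
      show m + 2 ≠ 0 by omega, if_false, if_true, Bool.false_eq_true, familyStep_left_last]
    congr 1
    funext o'
    split_ifs <;> rfl
  · have h : ∀ i : Fin m, Function.update a (m + 1) a₀ (i.1 + 1) = a (i.1 + 1) := by
      intro i
      rw [Function.update_of_ne]
      omega
    have h' : recWord m a (m + 1) = fun i => a (i.1 + 1) := by
      funext i; simp [recWord]
    simp only [pathState, pathRew, show m + 1 ≠ 0 by omega, show m + 1 ≠ m + 2 by omega,
      show m + 2 ≠ 0 by omega, if_false, if_true, familyStep_right_last, h, h']
    exact (PMF.map_const _ _).symm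

/-- The coin `o₀` in the starting state is a placeholder, invisible up to time m + 1; the true coin
is drawn in the last step. -/
theorem pexp_rollout_uniform (r : Bool) (k : ℕ) :
    ∀ (t : ℕ) (o₀ : Fin 3) (a : ℕ → Bool) (F : Traj (3 * m + 1) (k + 1) → ENNReal), 1 ≤ t →
      t + (k + 1) = m + 2 →
      pexp ((familyMDP m b).rollout (uniformPolicy (3 * m + 1)) (k + 1) (pathState b r o₀ a t)) F =
        pexp (PMF.uniformOfFintype (Fin (k + 1) → Bool)) fun c =>
          pexp (PMF.uniformOfFintype (Fin 3)) fun o =>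
            F (trajSegment (pathState b r o (extendAt a t c)) (pathRew b r o (extendAt a t c))
              (extendAt a t c) t (k + 1)) := by
  induction k with
  | zero =>
    intro t o₀ a F h1 h2
    obtain rfl : t = m + 1 := by omega
    have hs : ∀ a₀, (familyMDP m b).step (pathState b r o₀ a (m + 1)) a₀ = _ :=
      fun a₀ => familyStep_pathState_last b a₀
    rw [pexp_uniform_cons]
    simp only [MDP.rollout, pexp_bind, pexp_map, pexp_pure, uniformPolicy, hs]
    refine pexp_congr fun a₀ _ => ?_
    simp only [pexp_uniform (α := Fin 0 → Bool), Fintype.card_unique, Nat.cast_one, inv_one, one_mul,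
      Finset.univ_unique, Finset.sum_singleton]
    refine pexp_congr fun o _ => ?_
    have he : ∀ c : Fin 0 → Bool, extendAt a (m + 1) (Fin.cons a₀ c : Fin (0 + 1) → Bool) =
        Function.update a (m + 1) a₀ := by
      intro c
      rw [extendAt_cons]
      funext j
      simp [extendAt]
    rw [trajSegment_succ, trajSegment_zero, he]
    simp only [Function.update_self]
    rw [pathState_congr b r o₀ o le_rfl (a' := Function.update a (m + 1) a₀)]
    intro j hj
    rw [Function.update_of_ne hj.ne]
  | succ k ih =>
    intro t o₀ a F h1 h2
    have hs : ∀ a₀, (familyMDP m b).step (pathState b r o₀ a t) a₀ = _ :=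
      fun a₀ => familyStep_pathState b h1 (by omega) a₀
    rw [pexp_uniform_cons, MDP.rollout]
    simp only [pexp_bind, pexp_map, pexp_pure, hs, uniformPolicy]
    refine pexp_congr fun a₀ _ => ?_
    refine (ih (t + 1) o₀ (Function.update a t a₀) (fun τ => F (Traj.cons (pathState b r o₀ a t) a₀ 0 τ))
      (by omega) (by omega)).trans ?_
    refine pexp_congr fun c _ => pexp_congr fun o _ => ?_
    rw [trajSegment_succ _ _ _ t, extendAt_cons, extendAt_of_lt _ (Nat.lt_succ_self t),
      Function.update_self]
    congr 2
    · refine pathState_congr b r o₀ o (by omega) fun j hj => ?_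
      rw [extendAt_of_lt _ (by omega), Function.update_of_ne hj.ne]
    · simp [pathRew, show t ≠ m + 1 by omega]

/-- The trajectory that is determined by the branch, the actions and the coin of the left branch. -/
noncomputable def pathTraj (ω : Bool × (Fin (m + 2) → Bool) × Fin 3) : Traj (3 * m + 1) (m + 2) :=
  trajSegment (pathState b ω.1 ω.2.2 (extendAt (fun _ => false) 0 ω.2.1))
    (pathRew b ω.1 ω.2.2 (extendAt (fun _ => false) 0 ω.2.1)) (extendAt (fun _ => false) 0 ω.2.1)
    0 (m + 2)

/-- Reduces every probability about a trajectory to counting over the branch, the action word and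
the coin. -/
theorem trajLaw_uniform : (familyMDP m b).trajLaw (uniformPolicy (3 * m + 1)) =
    (PMF.uniformOfFintype (Bool × (Fin (m + 2) → Bool) × Fin 3)).map (pathTraj b) := by
  refine pmf_eq_of_pexp fun F => ?_
  have hs : ∀ a, (familyMDP m b).step (0, 0) a = (PMF.uniformOfFintype Bool).map fun r =>
      (0, pathState b r 0 (Function.update (fun _ => false) 0 a) 1) := by
    intro a
    refine (familyStep_zero b 0 a).trans ?_
    congr 1
  rw [MDP.trajLaw, pexp_bind, pexp_map, pexp_uniform_prod]
  have h0 : (familyMDP m b).start = PMF.pure (0, 0) := rfl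
  simp only [h0, pexp_pure, pexp_uniform_prod]
  rw [MDP.rollout]
  simp only [pexp_bind, pexp_map, hs, uniformPolicy]
  -- The rollout draws the first action before the branch; the product space lists the branch first.
  rw [pexp_comm]
  refine pexp_congr fun r _ => ?_
  rw [pexp_uniform_cons]
  refine pexp_congr fun a _ => ?_
  refine (pexp_rollout_uniform b r m 1 0 (Function.update (fun _ => false) 0 a)
    (fun τ => F (Traj.cons (0, 0) a 0 τ)) le_rfl (by omega)).trans ?_
  refine pexp_congr fun c _ => pexp_congr fun o _ => ?_
  simp only [pathTraj, trajSegment_succ _ _ _ 0, extendAt_cons]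
  rw [extendAt_of_lt _ (Nat.lt_succ_self 0), Function.update_self]
  simp [pathRew, pathState]

end law

/-! ### Classifiers with at most one non-zero weight -/

theorem thresh_single {k : ℕ} (j : Fin k) (c : ℝ) (x : Fin k → ℝ) :
    thresh (Pi.single j c) x = decide (0 < c * x j) := by
  simp [thresh]

theorem l0norm_single_le {k : ℕ} (j : Fin k) (c : ℝ) : l0norm (Pi.single j c) ≤ 1 := by
  rw [l0norm, Finset.card_le_one]
  intro a ha a' ha'
  simp only [Finset.mem_filter, Finset.mem_univ, true_and] at ha ha'
  have h : ∀ x, (Pi.single j c : Fin k → ℝ) x ≠ 0 → x = j := by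
    intro x hx
    by_contra hne
    exact hx (Pi.single_eq_of_ne (M := fun _ => ℝ) hne c)
  rw [h a ha, h a' ha']

theorem exists_eq_single_of_l0norm_le {k : ℕ} (hk : 0 < k) (w : Fin k → ℝ) (hw : l0norm w ≤ 1) :
    ∃ j c, w = Pi.single j c := by
  by_cases h : ∃ j, w j ≠ 0
  · obtain ⟨j, hj⟩ := h
    refine ⟨j, w j, ?_⟩
    funext x
    by_cases hx : x = j
    · subst hx; simp
    · rw [Pi.single_eq_of_ne hx]
      by_contra hne
      rw [l0norm, Finset.card_le_one] at hw
      exact hx (hw x (by simpa using hne) j (by simpa using hj))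
  · push Not at h
    exact ⟨⟨0, hk⟩, 0, by funext x; simp [h x]⟩

/-- Positive scaling of the weight does not affect the test against 0. This leaves three classifiers
per coordinate, which makes both the union bound and the exhaustive search finite. -/
theorem thresh_single_sign {k : ℕ} (j : Fin k) (c : ℝ) (x : Fin k → ℝ) :
    thresh (Pi.single j c) x = thresh (Pi.single j ((SignType.sign c : SignType) : ℝ)) x := by
  rw [thresh_single, thresh_single]
  rcases lt_trichotomy c 0 with h | rfl | h
  · have : 0 < c * x j ↔ 0 < -x j := by
      rw [← neg_mul_neg, mul_pos_iff_of_pos_left (neg_pos.2 h)]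
    simp [sign_neg h, this]
  · simp
  · simp [sign_pos h, mul_pos_iff_of_pos_left h]

theorem empErr_single_sign {n H N : ℕ} (D : Fin N → Traj n H) (t : Fin H) (j : Fin (n + n))
    (c : ℝ) : empErr D t (Pi.single j c) =
      empErr D t (Pi.single j ((SignType.sign c : SignType) : ℝ)) := by
  simp only [empErr, thresh_single_sign j c]

/-! ### The informative coordinate -/

section coordinate

variable {m : ℕ}

/-- The coordinate of `s^{u,i}` or `s^{d,i}`. -/
def udIdx (i : Fin m) (up : Bool) : Fin (3 * m + 1) := ⟨m + 2 * i.1 + (if up then 0 else 1), by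
  split_ifs <;> omega⟩

theorem endVec_udIdx (w : Fin m → Bool) (i : Fin m) (up : Bool) :
    endVec w (udIdx i up) = bitR (w i == up) := by
  have hi := i.2
  cases up
  · simp [endVec, mkVec, udIdx, show ¬ m + 2 * i.1 + 1 < m by omega,
      show m + 2 * i.1 + 1 < 3 * m by omega, show (m + 2 * i.1 + 1 - m) % 2 = 1 by omega,
      show (m + 2 * i.1 + 1 - m) / 2 = i.1 by omega]
  · simp [endVec, mkVec, udIdx, show m + 2 * i.1 < 3 * m by omega]

theorem endVec_congr {w w' : Fin m → Bool} (i : Fin m) (h : ∀ i' ≠ i, w i' = w' i')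
    {j : Fin (3 * m + 1)} (hj : ∀ up, j ≠ udIdx i up) : endVec w j = endVec w' j := by
  by_cases h1 : j.1 < m
  · simp [endVec, mkVec, h1]
  by_cases h2 : j.1 < 3 * m
  · have hne : (⟨(j.1 - m) / 2, by omega⟩ : Fin m) ≠ i := by
      rintro rfl
      by_cases h3 : (j.1 - m) % 2 = 0
      · exact hj true (by ext; simp [udIdx]; omega)
      · exact hj false (by ext; simp [udIdx]; omega)
    simp [endVec, mkVec, h1, h2, h _ hne]
  · simp [endVec, mkVec, h1, h2]

theorem bitR_nonneg (c : Bool) : 0 ≤ bitR c := by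
  cases c <;> simp [bitR]

theorem bitR_pos (c : Bool) : 0 < bitR c ↔ c = true := by
  cases c <;> simp [bitR]

theorem endVec_nonneg (w : Fin m → Bool) (j) : 0 ≤ endVec w j := by
  unfold endVec mkVec
  split_ifs <;> simp [bitR_nonneg]

theorem rightVec_nonneg (w : Fin m → Bool) (j) : 0 ≤ rightVec w j := by
  unfold rightVec mkVec
  split_ifs <;> simp [bitR_nonneg]

/-- The coordinate of the pair (state, final state) that reveals the action at time `i + 1`. -/
def goodIdx (b : Fin m → Bool) (i : Fin m) : Fin (3 * m + 1 + (3 * m + 1)) :=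
  Fin.natAdd _ (udIdx i (b i))

/-- The time step `i + 1`, at which the action is recorded in `s^{a,i+1}`. -/
def stepIdx (i : Fin m) : Fin (m + 2) := ⟨i.1 + 1, by omega⟩

variable (b : Fin m → Bool)

/-- The input of the classifier at time `i + 1`, on the trajectory `pathTraj b ω`. -/
noncomputable def pathFeat (i : Fin m) (ω : Bool × (Fin (m + 2) → Bool) × Fin 3) :
    Fin (3 * m + 1 + (3 * m + 1)) → ℝ :=
  Fin.append ((pathTraj b ω).state (stepIdx i).castSucc).2
    ((pathTraj b ω).state (Fin.last (m + 2))).2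

theorem pathTraj_act (ω : Bool × (Fin (m + 2) → Bool) × Fin 3) (t : Fin (m + 2)) :
    (pathTraj b ω).act t = ω.2.1 t := by
  simp [pathTraj, trajSegment, extendAt]

theorem extendAt_stepIdx (c : Fin (m + 2) → Bool) (i : Fin m) :
    extendAt (fun _ => false) 0 c (i.1 + 1) = c (stepIdx i) := by
  simp [extendAt, stepIdx]

theorem pathTraj_last (ω : Bool × (Fin (m + 2) → Bool) × Fin 3) :
    ((pathTraj b ω).state (Fin.last (m + 2))).2 =
      if ω.1 then endVec (fun i => ω.2.1 (stepIdx i) == b i)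
      else if ω.2.2 = 0 then endVec (fun _ => true) else 0 := by
  simp [pathTraj, trajSegment, pathState, extendAt_stepIdx]

theorem pathTraj_step (ω : Bool × (Fin (m + 2) → Bool) × Fin 3) (i : Fin m) :
    ((pathTraj b ω).state (stepIdx i).castSucc).2 =
      if ω.1 then rightVec (recWord m (extendAt (fun _ => false) 0 ω.2.1) (i.1 + 1)) else 0 := by
  have hi := i.2
  simp only [pathTraj, trajSegment, pathState, stepIdx, Fin.val_castSucc, zero_add,
    show i.1 + 1 ≠ m + 2 by omega, show i.1 + 1 ≠ 0 by omega, if_false]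

theorem pathTraj_rew (ω : Bool × (Fin (m + 2) → Bool) × Fin 3) :
    (pathTraj b ω).rew (Fin.last (m + 1)) =
      if ω.1 then if (fun i => ω.2.1 (stepIdx i)) = b then 1 else 0
      else if ω.2.2 = 0 then 1 else 0 := by
  simp [pathTraj, trajSegment, pathRew, extendAt_stepIdx]

/-- Reward 1 has two sources, the lucky coin on the left and a perfect word on the right, and both
lead to the same end vector. So the goal never depends on which one was sampled. -/
theorem pathTraj_last_of_rew (ω : Bool × (Fin (m + 2) → Bool) × Fin 3)
    (h : 1 ≤ (pathTraj b ω).rew (Fin.last (m + 1))) :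
    ((pathTraj b ω).state (Fin.last (m + 2))).2 = endVec fun _ => true := by
  rw [pathTraj_rew] at h
  rw [pathTraj_last]
  split_ifs at h ⊢ with h1 h2 h3
  · congr 1
    funext i
    simp [← h2]
  · norm_num at h
  · rfl
  · norm_num at h

theorem pathFeat_nonneg (i : Fin m) (ω) (j) : 0 ≤ pathFeat b i ω j := by
  rw [pathFeat, pathTraj_last, pathTraj_step]
  refine Fin.addCases (fun j => ?_) (fun j => ?_) j
  · rw [Fin.append_left]
    split_ifs
    · exact rightVec_nonneg _ _
    · exact le_rfl
  · rw [Fin.append_right]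
    split_ifs
    · exact endVec_nonneg _ _
    · exact endVec_nonneg _ _
    · exact le_rfl

/-- The u-bit is the truth value of "action equals b_i": it is the action itself if b_i = 1 and its
negation, with d the action, if b_i = 0. -/
theorem pathFeat_good (i : Fin m) (c o) : pathFeat b i (true, c, o) (goodIdx b i) =
    bitR (c (stepIdx i)) := by
  rw [pathFeat, goodIdx, Fin.append_right, pathTraj_last, if_pos rfl, endVec_udIdx]
  cases b i <;> simp

theorem pathFeat_left_of_ne (i : Fin m) (c) {o : Fin 3} (ho : o ≠ 0) :
    pathFeat b i (false, c, o) = 0 := by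
  rw [pathFeat, pathTraj_last, pathTraj_step]
  funext j
  refine Fin.addCases (fun j => ?_) (fun j => ?_) j
  · rw [Fin.append_left]; simp
  · rw [Fin.append_right]; simp [ho]

/-- On the left branch nothing is recorded, so a prediction cannot follow a flip of the action. -/
theorem pathFeat_left_congr (i : Fin m) (c c') (o : Fin 3) :
    pathFeat b i (false, c, o) = pathFeat b i (false, c', o) := by
  simp only [pathFeat, pathTraj_last, pathTraj_step]
  simp

/-- Flip the action at time `t`. -/
def flipAt {k : ℕ} (t : Fin k) (c : Fin k → Bool) : Fin k → Bool := Function.update c t (!c t)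

theorem flipAt_involutive {k : ℕ} (t : Fin k) : Function.Involutive (flipAt t) := by
  intro c
  simp [flipAt]

theorem flipAt_self {k : ℕ} (t : Fin k) (c : Fin k → Bool) : flipAt t c t = !c t := by
  simp [flipAt]

/-- On the right branch, the positive classifier on the informative coordinate is the only one that
is right both before and after a flip of the action. -/
theorem pathFeat_right_error (i : Fin m) (c o) (j) (s : SignType)
    (hjs : ¬ (j = goodIdx b i ∧ s = 1)) :
    thresh (Pi.single j (s : ℝ)) (pathFeat b i (true, c, o)) ≠ c (stepIdx i) ∨
      thresh (Pi.single j (s : ℝ)) (pathFeat b i (true, flipAt (stepIdx i) c, o)) ≠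
        !c (stepIdx i) := by
  simp only [thresh_single]
  by_cases hs : s = 1
  · subst hs
    simp only [and_true] at hjs
    -- If the flip does not change the coordinate, the prediction is the same for two opposite
    -- actions and one of them is wrong.
    by_cases heq : pathFeat b i (true, flipAt (stepIdx i) c, o) j = pathFeat b i (true, c, o) j
    · rw [heq]
      cases c (stepIdx i) <;> cases decide (0 < ((1 : SignType) : ℝ) * pathFeat b i (true, c, o) j) <;>
        simp
    · left
      -- The action at time i + 1 is not yet in the current state, and in the final state it affects
      -- only u and d at i. One of these is excluded by `hjs`; the other carries the negated action
      -- and is always wrong.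
      have hj : j = Fin.natAdd _ (udIdx i (!b i)) := by
        by_contra hne
        apply heq
        simp only [pathFeat, pathTraj_last, pathTraj_step, if_true]
        refine Fin.addCases (fun j _ _ => ?_) (fun j hjs hne => ?_) j hjs hne
        · rw [Fin.append_left, Fin.append_left]
          congr 1
          refine recWord_congr fun j hj => ?_
          by_cases hj2 : j < m + 2
          · simp only [extendAt, Nat.zero_le, zero_add, hj2, true_and, dif_pos]
            rw [flipAt, Function.update_of_ne]
            rw [stepIdx, ne_eq, Fin.ext_iff]
            simp only [Nat.sub_zero]
            omega
          · simp [extendAt, hj2]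
        · rw [Fin.append_right, Fin.append_right]
          refine endVec_congr i (fun i' hi' => ?_) fun up hup => ?_
          · rw [flipAt, Function.update_of_ne]
            rw [stepIdx, stepIdx, ne_eq, Fin.ext_iff]
            simp only [Nat.add_right_cancel_iff]
            exact fun h => hi' (Fin.ext h)
          · subst hup
            cases up <;> cases hb : b i <;> simp [goodIdx, hb] at hjs hne
      subst hj
      have : pathFeat b i (true, c, o) (Fin.natAdd _ (udIdx i (!b i))) = bitR (!c (stepIdx i)) := by
        rw [pathFeat, Fin.append_right, pathTraj_last, if_pos rfl, endVec_udIdx]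
        cases b i <;> simp
      rw [this]
      cases c (stepIdx i) <;> simp [bitR]
  · have h : ∀ ω, ¬ 0 < (s : ℝ) * pathFeat b i ω j := by
      intro ω
      have h1 : (s : ℝ) ≤ 0 := by cases s <;> simp at hs ⊢
      exact not_lt.2 (mul_nonpos_of_nonpos_of_nonneg h1 (pathFeat_nonneg b i ω j))
    simp only [h, decide_false]
    cases c (stepIdx i) <;> simp

/-- The Chernoff weight for the predictions `q` (informative) and `p` of the action `a`. -/
noncomputable def predWeight (q p a : Bool) : ℝ :=
  (if q ≠ a then 2 else 1) * (if p ≠ a then 1 / 2 else 1)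

/-- The Chernoff weight of a trajectory. -/
noncomputable def errWeight (b : Fin m → Bool) (i : Fin m) (j : Fin (3 * m + 1 + (3 * m + 1)))
    (s : SignType) (ω : Bool × (Fin (m + 2) → Bool) × Fin 3) : ℝ :=
  predWeight (thresh (Pi.single (goodIdx b i) 1) (pathFeat b i ω))
    (thresh (Pi.single j (s : ℝ)) (pathFeat b i ω)) (ω.2.1 (stepIdx i))

/-- Bound on the sum of the weights before and after a flip of the action. -/
noncomputable def pairBound (r : Bool) (o : Fin 3) : ℝ :=
  if r then 3 / 2 else if o = 0 then 5 / 2 else 2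

/-- On the right the informative classifier is never wrong and the other errs at least once: at most
1 + 1/2. On the left each classifier errs exactly once in the pair: the sum is 2 if they agree, in
particular on zero features, and 2 + 1/2 if they disagree. -/
theorem errWeight_add_flip (i : Fin m) (j) (s : SignType) (hjs : ¬ (j = goodIdx b i ∧ s = 1))
    (r : Bool) (c) (o : Fin 3) :
    errWeight b i j s (r, c, o) + errWeight b i j s (r, flipAt (stepIdx i) c, o) ≤
      pairBound r o := by
  simp only [errWeight, flipAt_self]
  cases r
  · rw [pathFeat_left_congr b i (flipAt (stepIdx i) c) c]
    by_cases ho : o = 0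
    · have key : ∀ q p a, predWeight q p a + predWeight q p (!a) ≤ pairBound false o := by
        intro q p a
        cases p <;> cases q <;> cases a <;> norm_num [predWeight, pairBound, ho]
      exact key _ _ _
    · have key : ∀ a, predWeight false false a + predWeight false false (!a) ≤
          pairBound false o := by
        intro a
        cases a <;> norm_num [predWeight, pairBound, ho]
      simpa [pathFeat_left_of_ne b i c ho, thresh_single] using key (c (stepIdx i))
  · have key : ∀ p q a, p ≠ a ∨ q ≠ !a →
        predWeight a p a + predWeight (!a) q (!a) ≤ pairBound true o := by
      intro p q a
      cases p <;> cases q <;> cases a <;> norm_num [predWeight, pairBound]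
    have hgood : ∀ c, thresh (Pi.single (goodIdx b i) 1) (pathFeat b i (true, c, o)) =
        c (stepIdx i) := by
      intro c
      simp [thresh_single, pathFeat_good, bitR_pos]
    rw [hgood, hgood, flipAt_self]
    exact key _ _ _ (pathFeat_right_error b i c o j s hjs)

theorem sum_errWeight_le (i : Fin m) (j) (s : SignType) (hjs : ¬ (j = goodIdx b i ∧ s = 1)) :
    ∑ ω, errWeight b i j s ω ≤ 11 / 12 * (6 * 2 ^ (m + 2)) := by
  have h1 : ∑ ω, errWeight b i j s ω =
      ∑ ω : Bool × (Fin (m + 2) → Bool) × Fin 3,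
        errWeight b i j s (ω.1, flipAt (stepIdx i) ω.2.1, ω.2.2) := by
    have hinv : Function.Involutive fun ω : Bool × (Fin (m + 2) → Bool) × Fin 3 =>
        (ω.1, flipAt (stepIdx i) ω.2.1, ω.2.2) := by
      intro ω
      simp [flipAt_involutive (stepIdx i) ω.2.1]
    exact (Equiv.sum_comp hinv.toPerm _).symm
  have h2 : ∑ ω, errWeight b i j s ω + ∑ ω, errWeight b i j s ω ≤
      ∑ ω : Bool × (Fin (m + 2) → Bool) × Fin 3, pairBound ω.1 ω.2.2 := by
    nth_rewrite 2 [h1]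
    rw [← Finset.sum_add_distrib]
    exact Finset.sum_le_sum fun ω _ => errWeight_add_flip b i j s hjs ω.1 ω.2.1 ω.2.2
  -- Per action word: 3 · 3/2 on the right, 5/2 + 2 + 2 on the left, together 11. Each weight is
  -- counted twice, and there are six choices of branch and coin, hence the mean 11/12.
  have h3 : ∑ ω : Bool × (Fin (m + 2) → Bool) × Fin 3, pairBound ω.1 ω.2.2 = 11 * 2 ^ (m + 2) := by
    simp only [Fintype.sum_prod_type, Fin.sum_univ_three, pairBound, Finset.sum_const,
      show (1 : Fin 3) ≠ 0 by decide, show (2 : Fin 3) ≠ 0 by decide]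
    simp
    ring
  linarith

theorem pexp_errWeight_le (i : Fin m) (j) (s : SignType) (hjs : ¬ (j = goodIdx b i ∧ s = 1)) :
    pexp (PMF.uniformOfFintype (Bool × (Fin (m + 2) → Bool) × Fin 3))
      (fun ω => ENNReal.ofReal (errWeight b i j s ω)) ≤ ENNReal.ofReal (11 / 12) := by
  have hnn : ∀ ω, 0 ≤ errWeight b i j s ω := by
    intro ω
    unfold errWeight predWeight
    positivity
  rw [pexp_uniform, ← ENNReal.ofReal_sum_of_nonneg fun ω _ => hnn ω]
  have hc : (Fintype.card (Bool × (Fin (m + 2) → Bool) × Fin 3) : ENNReal) =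
      ENNReal.ofReal (6 * 2 ^ (m + 2)) := by
    rw [← ENNReal.ofReal_natCast]
    congr 1
    simp only [Fintype.card_prod, Fintype.card_bool, Fintype.card_pi, Finset.prod_const,
      Finset.card_univ, Fintype.card_fin]
    push_cast
    ring
  rw [hc, mul_comm, ← div_eq_mul_inv]
  refine ENNReal.div_le_of_le_mul ?_
  rw [← ENNReal.ofReal_mul (by norm_num)]
  exact ENNReal.ofReal_le_ofReal (sum_errWeight_le b i j s hjs)

/-- Probability that a wrong classifier looks at least as good as the informative one. -/
theorem iidLaw_empErr_le (N : ℕ) (i : Fin m) (j) (s : SignType)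
    (hjs : ¬ (j = goodIdx b i ∧ s = 1)) :
    pexp (iidLaw ((familyMDP m b).trajLaw (uniformPolicy (3 * m + 1))) N)
      ({D | empErr D (stepIdx i) (Pi.single j (s : ℝ)) ≤
        empErr D (stepIdx i) (Pi.single (goodIdx b i) 1)}.indicator 1) ≤
      ENNReal.ofReal (11 / 12) ^ N := by
  classical
  have := iidLaw_card_le_card ((familyMDP m b).trajLaw (uniformPolicy (3 * m + 1)))
    (fun τ => thresh (Pi.single j (s : ℝ)) (Fin.append (τ.state (stepIdx i).castSucc).2
      (τ.state (Fin.last (m + 2))).2) ≠ τ.act (stepIdx i))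
    (fun τ => thresh (Pi.single (goodIdx b i) 1) (Fin.append (τ.state (stepIdx i).castSucc).2
      (τ.state (Fin.last (m + 2))).2) ≠ τ.act (stepIdx i))
    (ENNReal.ofReal (11 / 12)) N (by
      rw [trajLaw_uniform, pexp_map]
      refine Eq.trans_le (pexp_congr fun ω _ => ?_) (pexp_errWeight_le b i j s hjs)
      rw [pathTraj_act, errWeight, predWeight, pathFeat]
      congr)
  convert this using 6 <;> (simp only [empErr]; congr)

/-- Probability that no trajectory of the sample ends with reward `1`. -/
theorem iidLaw_no_reward (N : ℕ) :
    pexp (iidLaw ((familyMDP m b).trajLaw (uniformPolicy (3 * m + 1))) N)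
      ({D | ∀ i, (D i).rew (Fin.last (m + 1)) < 1}.indicator 1) ≤ ENNReal.ofReal (11 / 12) ^ N := by
  have h1 : pexp ((familyMDP m b).trajLaw (uniformPolicy (3 * m + 1)))
      ({τ | τ.rew (Fin.last (m + 1)) < 1}.indicator 1) ≤ ENNReal.ofReal (11 / 12) := by
    rw [trajLaw_uniform, pexp_map, pexp_uniform_prod, pexp_uniform]
    -- Rewards on the right branch are given away. The left branch alone yields (1 + 2/3) / 2 = 5/6
    -- ≤ 11/12.
    have ht : pexp (PMF.uniformOfFintype ((Fin (m + 2) → Bool) × Fin 3))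
        (fun x => ({τ : Traj (3 * m + 1) (m + 2) | τ.rew (Fin.last (m + 1)) < 1}.indicator 1
          (pathTraj b (true, x)) : ENNReal)) ≤ 1 :=
      pexp_le fun x _ => Set.indicator_le_self' (by simp) _
    have hf : pexp (PMF.uniformOfFintype ((Fin (m + 2) → Bool) × Fin 3))
        (fun x => ({τ : Traj (3 * m + 1) (m + 2) | τ.rew (Fin.last (m + 1)) < 1}.indicator 1
          (pathTraj b (false, x)) : ENNReal)) ≤ 3⁻¹ * 2 := by
      rw [pexp_uniform_prod]
      refine pexp_le fun c _ => ?_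
      rw [pexp_uniform, Fin.sum_univ_three]
      simp only [Set.indicator_apply, Set.mem_ofPred_eq, pathTraj_rew]
      simp [one_add_one_eq_two]
    rw [Fintype.sum_bool]
    calc _ ≤ (2 : ENNReal)⁻¹ * (1 + 3⁻¹ * 2) := by
          rw [Fintype.card_bool]
          push_cast
          gcongr
      _ ≤ _ := by
        rw [← ENNReal.toReal_le_toReal (by finiteness) (by finiteness)]
        rw [ENNReal.toReal_mul, ENNReal.toReal_add (by finiteness) (by finiteness)]
        norm_num
  refine le_trans (pexp_mono fun D _ => ?_) ((pexp_iidLaw_prod _ _ N).le.trans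
    (pow_le_pow_left₀ zero_le h1 N))
  by_cases hD : D ∈ {D : Fin N → Traj (3 * m + 1) (m + 2) | ∀ i, (D i).rew (Fin.last (m + 1)) < 1}
  · rw [Set.indicator_of_mem hD, Finset.prod_congr rfl fun i _ =>
      Set.indicator_of_mem (show D i ∈ {τ | τ.rew (Fin.last (m + 1)) < 1} from hD i) 1]
    simp
  · rw [Set.indicator_of_notMem hD]
    exact zero_le

/-- If some trajectory ends with reward `1` and the informative classifiers are strictly best, then
every output of the algorithm is optimal. -/
theorem gcPolicy_isOptimal {N : ℕ} (D : Fin N → Traj (3 * m + 1) (m + 2))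
    (hD : ∀ k, ∃ ω, D k = pathTraj b ω)
    (hrew : ∃ k, 1 ≤ (D k).rew (Fin.last (m + 1)))
    (herr : ∀ i j (s : SignType), ¬ (j = goodIdx b i ∧ s = 1) →
      empErr D (stepIdx i) (Pi.single (goodIdx b i) 1) < empErr D (stepIdx i) (Pi.single j (s : ℝ)))
    (g : Fin (3 * m + 1) → ℝ) (w : Fin (m + 2) → Fin (3 * m + 1 + (3 * m + 1)) → ℝ)
    (h : IsGCOutput 1 D g w) : (familyMDP m b).IsOptimal (gcPolicy g w) := by
  obtain ⟨⟨k, hg, hk⟩, hw⟩ := h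
  obtain ⟨k', hk'⟩ := hrew
  have hgoal : g = endVec fun _ => true := by
    obtain ⟨ω, hω⟩ := hD k
    have := hk'.trans (hk k')
    rw [hω] at this
    rw [hg, hω, pathTraj_last_of_rew b ω this]
  -- Only the actions at times 1, ..., m matter, so nothing has to be known about the weights at
  -- times 0 and m + 1.
  refine family_isOptimal_of_forall b _ fun i v => ?_
  obtain ⟨hl, hmin⟩ := hw (stepIdx i)
  obtain ⟨j, c, hjc⟩ := exists_eq_single_of_l0norm_le (by omega) _ hl
  have hgood : j = goodIdx b i ∧ SignType.sign c = 1 := by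
    by_contra hne
    have h1 := herr i j _ hne
    have h2 := hmin (Pi.single (goodIdx b i) 1) (l0norm_single_le _ _)
    rw [hjc, empErr_single_sign] at h2
    omega
  obtain ⟨rfl, hc⟩ := hgood
  have hc' : 0 < c := sign_eq_one_iff.1 hc
  have hi := i.2
  rw [gcPolicy, dif_pos (by simp only; omega)]
  have hi' : (⟨i.1 + 1, by omega⟩ : Fin (m + 2)) = stepIdx i := rfl
  simp only [hi', hjc, thresh_single, goodIdx, Fin.append_right, hgoal, endVec_udIdx]
  congr 1
  simp [mul_pos_iff_of_pos_left hc', bitR_pos]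

/-- Failure probability of the goal-conditioned algorithm. -/
theorem iidLaw_gcPolicy_suboptimal_le (N : ℕ) :
    (iidLaw ((familyMDP m b).trajLaw (uniformPolicy (3 * m + 1))) N).toOuterMeasure
      {D | ∀ (g : Fin (3 * m + 1) → ℝ) (w : Fin (m + 2) → Fin (3 * m + 1 + (3 * m + 1)) → ℝ),
        IsGCOutput 1 D g w → (familyMDP m b).IsOptimal (gcPolicy g w)}ᶜ ≤
      ENNReal.ofReal (18 * ((m + 2 : ℕ) : ℝ) ^ 2 * (11 / 12) ^ N) := by
  classical
  set p := iidLaw ((familyMDP m b).trajLaw (uniformPolicy (3 * m + 1))) N with hp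
  -- The first conjunct makes the event empty for the informative classifier itself, so the union
  -- can run over the whole product.
  set E : (Fin m × Fin (3 * m + 1 + (3 * m + 1)) × SignType) → Set (Fin N → Traj (3 * m + 1) (m + 2)) :=
    fun x => {D | ¬ (x.2.1 = goodIdx b x.1 ∧ x.2.2 = 1) ∧
      empErr D (stepIdx x.1) (Pi.single x.2.1 (x.2.2 : ℝ)) ≤
        empErr D (stepIdx x.1) (Pi.single (goodIdx b x.1) 1)} with hE
  set Z : Set (Fin N → Traj (3 * m + 1) (m + 2)) := {D | ∀ i, (D i).rew (Fin.last (m + 1)) < 1}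
  have hEx : ∀ x, pexp p ((E x).indicator 1) ≤ ENNReal.ofReal (11 / 12) ^ N := by
    rintro ⟨i, j, s⟩
    by_cases hjs : j = goodIdx b i ∧ s = 1
    · refine (pexp_le fun D _ => ?_).trans zero_le
      rw [Set.indicator_of_notMem]
      exact fun h => h.1 hjs
    · refine (pexp_mono fun D _ => ?_).trans (iidLaw_empErr_le b N i j s hjs)
      exact Set.indicator_le_indicator_of_subset (fun D hD => hD.2) (by simp) D
  rw [toOuterMeasure_eq_pexp]
  have hle : pexp p ({D | ∀ (g : Fin (3 * m + 1) → ℝ)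
      (w : Fin (m + 2) → Fin (3 * m + 1 + (3 * m + 1)) → ℝ),
        IsGCOutput 1 D g w → (familyMDP m b).IsOptimal (gcPolicy g w)}ᶜ.indicator 1) ≤
      pexp p fun D => Z.indicator 1 D + ∑ x, (E x).indicator 1 D := by
    refine pexp_mono fun D hD => ?_
    by_cases hZ : D ∈ Z
    · rw [Set.indicator_of_mem hZ]
      exact (Set.indicator_le_self' (by simp) D).trans le_self_add
    by_cases hEx : ∃ x, D ∈ E x
    · obtain ⟨x, hx⟩ := hEx
      calc _ ≤ (1 : (Fin N → Traj (3 * m + 1) (m + 2)) → ENNReal) D :=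
            Set.indicator_le_self' (by simp) D
        _ = (E x).indicator 1 D := by rw [Set.indicator_of_mem hx]
        _ ≤ ∑ x, (E x).indicator 1 D :=
            Finset.single_le_sum (f := fun x => (E x).indicator 1 D) (fun _ _ => zero_le)
              (Finset.mem_univ x)
        _ ≤ _ := le_add_self
    · rw [Set.indicator_of_notMem]
      · exact zero_le
      · refine not_not.2 (gcPolicy_isOptimal b D (fun k => ?_) ?_ fun i j s hjs => ?_)
        · have := mem_support_of_mem_iidLaw _ _ D hD k
          rw [trajLaw_uniform, PMF.mem_support_map_iff] at this
          obtain ⟨ω, -, hω⟩ := this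
          exact ⟨ω, hω.symm⟩
        · by_contra! h
          exact hZ h
        · by_contra! h
          exact hEx ⟨(i, j, s), hjs, h⟩
  refine hle.trans ?_
  rw [pexp_add, pexp_sum]
  refine (add_le_add (iidLaw_no_reward b N) (Finset.sum_le_sum fun x _ => hEx x)).trans ?_
  rw [Finset.sum_const, Finset.card_univ, nsmul_eq_mul, ← ENNReal.ofReal_pow (by norm_num),
    ← ENNReal.ofReal_natCast, ← ENNReal.ofReal_mul (by positivity),
    ← ENNReal.ofReal_add (by positivity) (by positivity)]
  refine ENNReal.ofReal_le_ofReal ?_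
  rw [← one_add_mul]
  gcongr
  -- The number of events is 1 + 3 m (6 m + 2), which is at most 18 (m + 2)^2.
  have : Fintype.card SignType = 3 := rfl
  simp only [Fintype.card_prod, Fintype.card_fin, this]
  push_cast
  nlinarith [(Nat.cast_nonneg m : (0 : ℝ) ≤ m)]

/-- Bernoulli's inequality for (12/11)^N. Decay like 1/N is enough, because the sample size may be
linear in 1/δ. -/
theorem pow_mul_le (N : ℕ) : ((11 : ℝ) / 12) ^ N * N ≤ 12 := by
  have h := one_add_mul_le_pow (show (-2 : ℝ) ≤ 1 / 11 by norm_num) N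
  have h2 : ((11 : ℝ) / 12) ^ N * (1 + 1 / 11) ^ N = 1 := by
    rw [← mul_pow]; norm_num
  have h3 : (0 : ℝ) < (11 / 12) ^ N := by positivity
  nlinarith [(Nat.cast_nonneg N : (0 : ℝ) ≤ N)]

theorem iidLaw_gcPolicy_isOptimal {δ : ℝ} (hδ : 0 < δ) {N : ℕ}
    (hN : 216 * ((m + 2 : ℕ) : ℝ) ^ 2 * (1 / δ) ≤ N) :
    ENNReal.ofReal (1 - δ) ≤
      (iidLaw ((familyMDP m b).trajLaw (uniformPolicy (3 * m + 1))) N).toOuterMeasure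
        {D | ∀ (g : Fin (3 * m + 1) → ℝ) (w : Fin (m + 2) → Fin (3 * m + 1 + (3 * m + 1)) → ℝ),
          IsGCOutput 1 D g w → (familyMDP m b).IsOptimal (gcPolicy g w)} := by
  -- Here 216 = 18 · 12, with the 12 from `pow_mul_le`.
  have hle : 18 * ((m + 2 : ℕ) : ℝ) ^ 2 * (11 / 12) ^ N ≤ δ := by
    have h1 := pow_mul_le N
    have h2 : 216 * ((m + 2 : ℕ) : ℝ) ^ 2 ≤ N * δ := by
      rw [mul_one_div, div_le_iff₀ hδ] at hN
      exact hN
    have h4 : (0 : ℝ) < ((m + 2 : ℕ) : ℝ) ^ 2 := by positivity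
    have h5 : (0 : ℝ) < N := by
      by_contra h
      have : (N : ℝ) * δ ≤ 0 := mul_nonpos_of_nonpos_of_nonneg (not_lt.1 h) hδ.le
      linarith
    refine le_of_mul_le_mul_right ?_ h5
    nlinarith
  have hc := (iidLaw_gcPolicy_suboptimal_le b N).trans (ENNReal.ofReal_le_ofReal hle)
  have h1 := toOuterMeasure_add_compl
    (iidLaw ((familyMDP m b).trajLaw (uniformPolicy (3 * m + 1))) N)
    {D | ∀ (g : Fin (3 * m + 1) → ℝ) (w : Fin (m + 2) → Fin (3 * m + 1 + (3 * m + 1)) → ℝ),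
      IsGCOutput 1 D g w → (familyMDP m b).IsOptimal (gcPolicy g w)}
  rw [ENNReal.ofReal_sub _ hδ.le, ENNReal.ofReal_one, tsub_le_iff_right, ← h1]
  gcongr

end coordinate

/-! ### Reasoning about programs -/

namespace RCmd

/-- From memories in `P`, the program `c` reaches `Q` within `k` steps. -/
def Triple (P : RStore → Prop) (c : RCmd) (k : ℕ) (Q : RStore → Prop) : Prop :=
  ∀ σ, P σ → Q (c.exec σ).1 ∧ (c.exec σ).2 ≤ k

theorem Triple.seq {P Q R : RStore → Prop} {c d : RCmd} {k l : ℕ} (h : Triple P c k Q)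
    (h' : Triple Q d l R) : Triple P (c.seq d) (k + l) R := by
  intro σ hσ
  obtain ⟨h1, h2⟩ := h σ hσ
  obtain ⟨h3, h4⟩ := h' _ h1
  exact ⟨h3, Nat.add_le_add h2 h4⟩

theorem Triple.mono {P P' Q Q' : RStore → Prop} {c : RCmd} {k k' : ℕ} (h : Triple P c k Q)
    (hP : ∀ σ, P' σ → P σ) (hk : k ≤ k') (hQ : ∀ σ, Q σ → Q' σ) : Triple P' c k' Q' :=
  fun σ hσ => ⟨hQ _ (h σ (hP σ hσ)).1, (h σ (hP σ hσ)).2.trans hk⟩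

theorem Triple.loop {I : ℕ → RStore → Prop} {c : RCmd} {x k n : ℕ}
    (h : ∀ i < n, Triple (I i) c k (I (i + 1))) (hn : ∀ σ, I 0 σ → σ.nreg x = n) :
    Triple (I 0) (loop x c) (n * (k + 1) + 1) (I n) := by
  intro σ hσ
  have key : ∀ j ≤ n,
      I j ((fun p : RStore × ℕ => ((c.exec p.1).1, p.2 + (c.exec p.1).2 + 1))^[j] (σ, 1)).1 ∧
      ((fun p : RStore × ℕ => ((c.exec p.1).1, p.2 + (c.exec p.1).2 + 1))^[j] (σ, 1)).2 ≤
        j * (k + 1) + 1 := by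
    intro j
    induction j with
    | zero => intro _; exact ⟨hσ, by simp⟩
    | succ j ih =>
      intro hj
      obtain ⟨h1, h2⟩ := ih (by omega)
      obtain ⟨h3, h4⟩ := h j (by omega) _ h1
      rw [Function.iterate_succ_apply']
      refine ⟨h3, ?_⟩
      simp only
      rw [add_mul, one_mul]
      omega
  rw [exec, hn σ hσ]
  exact key n le_rfl

end RCmd

/-! ### The program

Registers: `0, 1, 2` hold `N`, `H`, `n`, `3` and `4` hold `0` and `1`, `5` holds `H - 1`, `6` is the
inner counter, `7` the chosen trajectory, `8` the time, `9` the feature, `10` holds `2 n`, `11` the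
chosen feature, `12` is an address.  Real registers: `0` and `10` hold `0` and `1`, `1` the best
reward, `3` the number of errors, `4` the sign, `8` and `9` the smallest number of errors and its
sign, and `2, 5, 6, 7` are auxiliary. -/

namespace GCProg

open RCmd

/-- Set the constants. -/
def setup : RCmd :=
  .seq (.nconst 4 1) (.seq (.nsub 5 1 4) (.seq (.nadd 10 2 2) (.seq (.rconst 10 1)
    (.seq (.nconst 6 0) (.read 1 2 6 5 3)))))

/-- Compare the reward of one trajectory with the best one. -/
def goalBody : RCmd :=
  .seq (.read 2 2 6 5 3) (.seq (.rifLt 1 2 (.seq (.nadd 7 6 3) (.radd 1 2 0)) .skip) (.nadd 6 6 4))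

/-- Copy one coordinate of the goal. -/
def copyBody : RCmd :=
  .seq (.read 2 0 7 1 6) (.seq (.write 3 3 3 6 2) (.nadd 6 6 4))

/-- Read the feature with the number in register `9`. -/
def readFeat : RCmd :=
  .nifLt 9 2 (.read 5 0 6 8 9) (.seq (.nsub 12 9 2) (.read 5 0 6 1 12))

/-- Add the error of one trajectory. -/
def countBody : RCmd :=
  .seq readFeat (.seq (.rmul 6 4 5) (.seq (.read 7 1 6 8 3)
    (.seq (.rifLt 0 6 (.seq (.rsub 7 10 7) (.radd 3 3 7)) (.radd 3 3 7)) (.nadd 6 6 4))))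

/-- Count the errors of a classifier. -/
def count : RCmd := .seq (.rconst 3 0) (.seq (.nconst 6 0) (.loop 0 countBody))

/-- Keep the better one of two candidates. -/
def keepBetter : RCmd :=
  .rifLt 3 8 (.seq (.radd 8 3 0) (.seq (.radd 9 4 0) (.nadd 11 9 3))) .skip

/-- Try the feature in register `9` with the sign `z`. -/
def tryCand (z : ℤ) : RCmd := .seq (.rconst 4 z) (.seq count keepBetter)

/-- Try both signs of one feature. -/
def featBody : RCmd := .seq (tryCand 1) (.seq (tryCand (-1)) (.nadd 9 9 4))

/-- Start with the zero classifier. -/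
def initCand : RCmd :=
  .seq (.nconst 9 0) (.seq (.rconst 4 0) (.seq count
    (.seq (.radd 8 3 0) (.seq (.radd 9 4 0) (.nconst 11 0)))))

/-- Choose the weights for one time step. -/
def timeBody : RCmd :=
  .seq initCand (.seq (.loop 10 featBody) (.seq (.write 4 8 11 3 9) (.nadd 8 8 4)))

/-- The goal-conditioned algorithm with one non-zero weight. -/
def prog : RCmd :=
  .seq setup (.seq (.loop 0 goalBody) (.seq (.nconst 6 0) (.seq (.loop 2 copyBody)
    (.seq (.nconst 8 0) (.loop 1 timeBody)))))

/-! ### Correctness and running time of the program -/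

section correctness

variable {n h N : ℕ} (D : Fin N → Traj n (h + 1))

/-- The constants and the input are in place. -/
structure Base (σ : RStore) : Prop where
  n0 : σ.nreg 0 = N
  n1 : σ.nreg 1 = h + 1
  n2 : σ.nreg 2 = n
  n3 : σ.nreg 3 = 0
  n4 : σ.nreg 4 = 1
  n5 : σ.nreg 5 = h
  n10 : σ.nreg 10 = n + n
  r0 : σ.rreg 0 = 0
  r10 : σ.rreg 10 = 1
  inp : ∀ k < 3, σ.arr k = (loadData D).arr k

/-- The reward of trajectory `i` in the input. -/
noncomputable def lastRew (i : ℕ) : ℝ := (loadData D).arr 2 i h 0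

theorem setup_spec : Triple (fun σ => σ = loadData D) setup 6 (fun σ => Base D σ ∧ σ.nreg 6 = 0 ∧
    σ.nreg 7 = 0 ∧ σ.rreg 1 = lastRew D 0 ∧ ∀ k, 3 ≤ k → σ.arr k = 0) := by
  rintro σ rfl
  refine ⟨⟨?_, ?_, ?_, ?_, ?_⟩, ?_⟩
  · constructor <;> simp [setup, exec, loadData]
  · simp [setup, exec]
  · simp [setup, exec, loadData]
  · simp [setup, exec, lastRew]
    simp [loadData]
  · intro k hk
    funext i j l
    simp [setup, exec, loadData, show k ≠ 0 by omega, show k ≠ 1 by omega, show k ≠ 2 by omega]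
  · simp [setup, exec]

/-- The alternative `σ.nreg 7 = 0` covers the start, when trajectory 0 is the provisional best
before it has been examined. -/
theorem goalBody_spec (i : ℕ) : Triple
    (fun σ => Base D σ ∧ σ.nreg 6 = i ∧ (σ.nreg 7 < i ∨ σ.nreg 7 = 0) ∧
      σ.rreg 1 = lastRew D (σ.nreg 7) ∧ (∀ i' < i, lastRew D i' ≤ σ.rreg 1) ∧
      ∀ k, 3 ≤ k → σ.arr k = 0) goalBody 6
    (fun σ => Base D σ ∧ σ.nreg 6 = i + 1 ∧ (σ.nreg 7 < i + 1 ∨ σ.nreg 7 = 0) ∧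
      σ.rreg 1 = lastRew D (σ.nreg 7) ∧ (∀ i' < i + 1, lastRew D i' ≤ σ.rreg 1) ∧
      ∀ k, 3 ≤ k → σ.arr k = 0) := by
  rintro σ ⟨hB, h6, h7, h1, hle, harr⟩
  have hread : σ.arr 2 i h 0 = lastRew D i := by
    rw [hB.inp 2 (by omega), lastRew]
  by_cases hlt : σ.rreg 1 < lastRew D i
  · have he : goalBody.exec σ = (⟨Function.update (Function.update σ.nreg 7 i) 6 (i + 1),
        Function.update (Function.update σ.rreg 2 (lastRew D i)) 1 (lastRew D i), σ.arr⟩, 5) := by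
      simp [goalBody, exec, hread, hlt, h6, hB.n3, hB.n4, hB.n5, hB.r0]
    rw [he]
    refine ⟨⟨?_, ?_, ?_, ?_, ?_, harr⟩, by simp⟩
    · constructor <;> simp [hB.n0, hB.n1, hB.n2, hB.n3, hB.n4, hB.n5, hB.n10, hB.r0, hB.r10]
      exact hB.inp
    · simp
    · simp
    · simp
    · intro i' hi'
      simp only [Function.update_self]
      rcases Nat.lt_succ_iff_lt_or_eq.1 hi' with h | rfl
      · exact (hle i' h).trans hlt.le
      · exact le_rfl
  · have he : goalBody.exec σ = (⟨Function.update σ.nreg 6 (i + 1),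
        Function.update σ.rreg 2 (lastRew D i), σ.arr⟩, 4) := by
      simp [goalBody, exec, hread, hlt, h6, hB.n3, hB.n4, hB.n5]
    rw [he]
    refine ⟨⟨?_, ?_, ?_, ?_, ?_, harr⟩, by simp⟩
    · constructor <;> simp [hB.n0, hB.n1, hB.n2, hB.n3, hB.n4, hB.n5, hB.n10, hB.r0, hB.r10]
      exact hB.inp
    · simp
    · simp only [ne_eq, Nat.reduceEqDiff, not_false_eq_true, Function.update_of_ne]
      omega
    · simpa using h1
    · intro i' hi'
      simp only [ne_eq, OfNat.one_ne_ofNat, not_false_eq_true, Function.update_of_ne]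
      rcases Nat.lt_succ_iff_lt_or_eq.1 hi' with h | rfl
      · exact hle i' h
      · exact not_lt.1 hlt

/-- The chosen trajectory has maximal last reward. -/
def Best (g : ℕ) : Prop := (0 < N → g < N) ∧ ∀ i < N, lastRew D i ≤ lastRew D g

theorem copyBody_spec (g i : ℕ) : Triple
    (fun σ => Base D σ ∧ σ.nreg 6 = i ∧ σ.nreg 7 = g ∧
      (∀ j < i, σ.arr 3 0 0 j = (loadData D).arr 0 g (h + 1) j) ∧ σ.arr 4 = 0) copyBody 3
    (fun σ => Base D σ ∧ σ.nreg 6 = i + 1 ∧ σ.nreg 7 = g ∧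
      (∀ j < i + 1, σ.arr 3 0 0 j = (loadData D).arr 0 g (h + 1) j) ∧ σ.arr 4 = 0) := by
  rintro σ ⟨hB, h6, h7, hcopy, harr⟩
  refine ⟨⟨?_, ?_, ?_, ?_, ?_⟩, ?_⟩
  · constructor <;>
      simp [copyBody, exec, hB.n0, hB.n1, hB.n2, hB.n3, hB.n4, hB.n5, hB.n10, hB.r0, hB.r10]
    intro k hk
    rw [← hB.inp k hk]
    funext i' j' l'
    simp [show k ≠ 3 by omega]
  · simp [copyBody, exec, h6, hB.n4]
  · simp [copyBody, exec, h7]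
  · intro j hj
    simp only [copyBody, exec, hB.n3, h6, h7, hB.n1, hB.inp 0 (by omega), Function.update_self,
      true_and]
    by_cases hji : j = i
    · simp [hji]
    · rw [if_neg hji]
      exact hcopy j (by omega)
  · rw [← harr]
    funext i' j' l'
    simp [copyBody, exec]
  · simp [copyBody, exec]

/-- The feature `j` of trajectory `i` at time `t`, in the input. -/
noncomputable def feat (t i j : ℕ) : ℝ :=
  if j < n then (loadData D).arr 0 i t j else (loadData D).arr 0 i (h + 1) (j - n)

open Classical in
/-- The error of the classifier with weight `c` at `j`, on trajectory `i`. -/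
noncomputable def errAt (t j : ℕ) (c : ℝ) (i : ℕ) : ℝ :=
  if 0 < c * feat D t i j then 1 - (loadData D).arr 1 i t 0 else (loadData D).arr 1 i t 0

/-- The number of errors of the classifier with weight `c` at `j`. -/
noncomputable def errSum (t j : ℕ) (c : ℝ) : ℝ := ∑ i ∈ Finset.range N, errAt D t j c i

/-- What counting leaves unchanged. -/
structure Same (σ₀ σ : RStore) : Prop where
  n8 : σ.nreg 8 = σ₀.nreg 8
  n9 : σ.nreg 9 = σ₀.nreg 9
  n11 : σ.nreg 11 = σ₀.nreg 11
  r4 : σ.rreg 4 = σ₀.rreg 4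
  r8 : σ.rreg 8 = σ₀.rreg 8
  r9 : σ.rreg 9 = σ₀.rreg 9
  arr : σ.arr = σ₀.arr

/-- The value z of the address register is scratch and is left unspecified. -/
theorem readFeat_spec (σ : RStore) (hB : Base D σ) : ∃ z,
    (readFeat.exec σ).1 = ⟨Function.update σ.nreg 12 z, Function.update σ.rreg 5
      (feat D (σ.nreg 8) (σ.nreg 6) (σ.nreg 9)), σ.arr⟩ ∧ (readFeat.exec σ).2 ≤ 3 := by
  by_cases hlt : σ.nreg 9 < n
  · refine ⟨σ.nreg 12, ?_, ?_⟩ <;>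
      simp [readFeat, exec, hB.n2, hlt, feat, hB.inp 0 (by omega)]
  · refine ⟨σ.nreg 9 - n, ?_, ?_⟩ <;>
      simp [readFeat, exec, hB.n2, hlt, feat, hB.inp 0 (by omega), hB.n1]

/-- The memory `σ₀` freezes the time, the feature and the sign for the duration of the count. -/
theorem countBody_spec (σ₀ : RStore) (i : ℕ) : Triple
    (fun σ => Base D σ ∧ Same σ₀ σ ∧ σ.nreg 6 = i ∧ σ.rreg 3 =
      ∑ i' ∈ Finset.range i, errAt D (σ₀.nreg 8) (σ₀.nreg 9) (σ₀.rreg 4) i') countBody 9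
    (fun σ => Base D σ ∧ Same σ₀ σ ∧ σ.nreg 6 = i + 1 ∧ σ.rreg 3 =
      ∑ i' ∈ Finset.range (i + 1), errAt D (σ₀.nreg 8) (σ₀.nreg 9) (σ₀.rreg 4) i') := by
  rintro σ ⟨hB, hS, h6, hsum⟩
  obtain ⟨z, h1, h2⟩ := readFeat_spec D σ hB
  rw [hS.n8, hS.n9, h6] at h1
  rw [Finset.sum_range_succ, ← hsum, errAt]
  by_cases hlt : 0 < σ₀.rreg 4 * feat D (σ₀.nreg 8) i (σ₀.nreg 9)
  · have hlt' : σ.rreg 0 < σ.rreg 4 * feat D (σ₀.nreg 8) i (σ₀.nreg 9) := by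
      rwa [hB.r0, hS.r4]
    rw [if_pos hlt]
    simp [countBody, exec, h1, hlt', h6, hB.r10, hB.n3, hS.n8, hB.inp 1 (by omega), hB.n4]
    refine ⟨⟨?_, ?_⟩, by omega⟩
    · constructor <;> simp [hB.n0, hB.n1, hB.n2, hB.n3, hB.n4, hB.n5, hB.n10, hB.r0, hB.r10]
      exact hB.inp
    · constructor <;> simp [hS.n8, hS.n9, hS.n11, hS.r4, hS.r8, hS.r9, hS.arr]
  · have hlt' : ¬ σ.rreg 0 < σ.rreg 4 * feat D (σ₀.nreg 8) i (σ₀.nreg 9) := by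
      rwa [hB.r0, hS.r4]
    rw [if_neg hlt]
    simp [countBody, exec, h1, hlt', h6, hB.n3, hS.n8, hB.inp 1 (by omega), hB.n4]
    refine ⟨⟨?_, ?_⟩, by omega⟩
    · constructor <;> simp [hB.n0, hB.n1, hB.n2, hB.n3, hB.n4, hB.n5, hB.n10, hB.r0, hB.r10]
      exact hB.inp
    · constructor <;> simp [hS.n8, hS.n9, hS.n11, hS.r4, hS.r8, hS.r9, hS.arr]

theorem count_spec (σ₀ : RStore) : Triple (fun σ => Base D σ ∧ Same σ₀ σ) count (N * 10 + 3)
    (fun σ => Base D σ ∧ Same σ₀ σ ∧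
      σ.rreg 3 = errSum D (σ₀.nreg 8) (σ₀.nreg 9) (σ₀.rreg 4)) := by
  have hloop := Triple.loop (x := 0) (fun i (_ : i < N) => countBody_spec D σ₀ i)
    (fun σ hσ => hσ.1.n0)
  refine (Triple.seq (k := 1) (Q := fun σ => Base D σ ∧ Same σ₀ σ ∧ σ.rreg 3 = 0) ?_
    (Triple.seq (k := 1) ?_ hloop)).mono (fun _ h => h) (by omega)
      fun σ hσ => ⟨hσ.1, hσ.2.1, hσ.2.2.2⟩
  · rintro σ ⟨hB, hS⟩
    refine ⟨⟨?_, ?_, ?_⟩, le_rfl⟩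
    · constructor <;> simp [exec, hB.n0, hB.n1, hB.n2, hB.n3, hB.n4, hB.n5, hB.n10, hB.r0, hB.r10]
      exact hB.inp
    · constructor <;> simp [exec, hS.n8, hS.n9, hS.n11, hS.r4, hS.r8, hS.r9, hS.arr]
    · simp [exec]
  · rintro σ ⟨hB, hS, h3⟩
    refine ⟨⟨?_, ?_, ?_, ?_⟩, le_rfl⟩
    · constructor <;> simp [exec, hB.n0, hB.n1, hB.n2, hB.n3, hB.n4, hB.n5, hB.n10, hB.r0, hB.r10]
      exact hB.inp
    · constructor <;> simp [exec, hS.n8, hS.n9, hS.n11, hS.r4, hS.r8, hS.r9, hS.arr]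
    · simp [exec]
    · simpa [exec] using h3

/-- The candidate in the registers `8` (real), `9` (real) and `11` is at least as good as the zero
classifier and the candidates in `S`; the time is `t`, the feature is `j`, the arrays are `arr`. -/
structure Leading (t j : ℕ) (arr : ℕ → ℕ → ℕ → ℕ → ℝ) (S : ℕ → ℤ → Prop) (σ : RStore) : Prop where
  base : Base D σ
  time : σ.nreg 8 = t
  feature : σ.nreg 9 = j
  arr : σ.arr = arr
  mem : σ.nreg 11 < n + n ∨ σ.nreg 11 = 0
  best : σ.rreg 8 = errSum D t (σ.nreg 11) (σ.rreg 9)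
  zero : σ.rreg 8 ≤ errSum D t 0 0
  cand : ∀ j' z, S j' z → σ.rreg 8 ≤ errSum D t j' (z : ℝ)

theorem tryCand_spec (t j : ℕ) (hj : j < n + n) (arr) (S : ℕ → ℤ → Prop) (z : ℤ) :
    Triple (Leading D t j arr S) (tryCand z) (N * 10 + 8)
      (Leading D t j arr fun j' z' => S j' z' ∨ (j' = j ∧ z' = z)) := by
  intro σ hL
  have hB := hL.base
  set σ₁ : RStore := ⟨σ.nreg, Function.update σ.rreg 4 (z : ℝ), σ.arr⟩
  have h1 : Base D σ₁ := by
    constructor <;> simp [σ₁, hB.n0, hB.n1, hB.n2, hB.n3, hB.n4, hB.n5, hB.n10, hB.r0, hB.r10]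
    exact hB.inp
  obtain ⟨⟨hB', hS, h3⟩, hcost⟩ := count_spec D σ₁ _ ⟨h1, ⟨rfl, rfl, rfl, rfl, rfl, rfl, rfl⟩⟩
  have e8 : σ₁.nreg 8 = t := hL.time
  have e9 : σ₁.nreg 9 = j := hL.feature
  have e4 : σ₁.rreg 4 = z := by simp [σ₁]
  rw [e8, e9, e4] at h3
  have he : (tryCand z).exec σ = ((keepBetter.exec (count.exec σ₁).1).1,
    1 + ((count.exec σ₁).2 + (keepBetter.exec (count.exec σ₁).1).2)) := rfl
  rw [he]
  generalize (count.exec σ₁).2 = cost at hcost ⊢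
  generalize (count.exec σ₁).1 = τ at hB' hS h3 ⊢
  have h8 : τ.rreg 8 = σ.rreg 8 := by simpa [σ₁] using hS.r8
  have h9 : τ.rreg 9 = σ.rreg 9 := by simpa [σ₁] using hS.r9
  have h4 : τ.rreg 4 = z := hS.r4.trans e4
  have n8 : τ.nreg 8 = t := hS.n8.trans hL.time
  have n9 : τ.nreg 9 = j := hS.n9.trans hL.feature
  have n11 : τ.nreg 11 = σ.nreg 11 := hS.n11
  have harr : τ.arr = arr := hS.arr.trans hL.arr
  by_cases hlt : τ.rreg 3 < τ.rreg 8
  · have hk : keepBetter.exec τ = (⟨Function.update τ.nreg 11 j, Function.update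
        (Function.update τ.rreg 8 (errSum D t j z)) 9 z, τ.arr⟩, 4) := by
      rw [h3] at hlt
      simp [keepBetter, exec, hlt, h3, hB'.r0, hB'.n3, n9, h4]
    rw [hk]
    have hlt' : errSum D t j z < σ.rreg 8 := by rwa [← h3, ← h8]
    refine ⟨⟨?_, ?_, ?_, ?_, ?_, ?_, ?_, ?_⟩, by simp only; omega⟩
    · constructor <;> simp [hB'.n0, hB'.n1, hB'.n2, hB'.n3, hB'.n4, hB'.n5, hB'.n10, hB'.r0, hB'.r10]
      exact hB'.inp
    · simpa using n8
    · simpa using n9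
    · exact harr
    · simp [hj]
    · simp
    · simpa using hlt'.le.trans hL.zero
    · rintro j' z' (h | ⟨rfl, rfl⟩)
      · simpa using hlt'.le.trans (hL.cand j' z' h)
      · simp
  · have hk : keepBetter.exec τ = (τ, 2) := by
      simp [keepBetter, exec, hlt]
    rw [hk]
    refine ⟨⟨hB', n8, n9, harr, ?_, ?_, ?_, ?_⟩, by simp only; omega⟩
    · rw [n11]; exact hL.mem
    · rw [h8, h9, n11]; exact hL.best
    · rw [h8]; exact hL.zero
    · rintro j' z' (h | ⟨rfl, rfl⟩)
      · rw [h8]; exact hL.cand j' z' h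
      · rw [← h3]; exact not_lt.1 hlt

theorem featBody_spec (t j : ℕ) (hj : j < n + n) (arr) :
    Triple (Leading D t j arr fun j' z => j' < j ∧ (z = 1 ∨ z = -1)) featBody (N * 20 + 17)
      (Leading D t (j + 1) arr fun j' z => j' < j + 1 ∧ (z = 1 ∨ z = -1)) := by
  refine ((tryCand_spec D t j hj arr _ 1).seq ((tryCand_spec D t j hj arr _ (-1)).seq (l := 1)
    ?_)).mono (fun _ h => h) (by omega) fun _ h => h
  intro σ hL
  have hB := hL.base
  refine ⟨⟨?_, ?_, ?_, ?_, ?_, ?_, ?_, ?_⟩, le_rfl⟩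
  · constructor <;> simp [exec, hB.n0, hB.n1, hB.n2, hB.n3, hB.n4, hB.n5, hB.n10, hB.r0, hB.r10]
    exact hB.inp
  · simpa [exec] using hL.time
  · simp [exec, hL.feature, hB.n4]
  · exact hL.arr
  · simpa [exec] using hL.mem
  · simpa [exec] using hL.best
  · exact hL.zero
  · rintro j' z ⟨h1, h2⟩
    refine hL.cand j' z ?_
    rcases Nat.lt_succ_iff_lt_or_eq.1 h1 with h | rfl
    · exact Or.inl (Or.inl ⟨h, h2⟩)
    · rcases h2 with rfl | rfl
      · exact Or.inl (Or.inr ⟨rfl, rfl⟩)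
      · exact Or.inr ⟨rfl, rfl⟩

/-- With weight 0 the feature is irrelevant, so feature 0 stands for the zero classifier. -/
theorem initCand_spec (t : ℕ) (arr) :
    Triple (fun σ => Base D σ ∧ σ.nreg 8 = t ∧ σ.arr = arr) initCand (N * 10 + 8)
      (Leading D t 0 arr fun j' z => j' < 0 ∧ (z = 1 ∨ z = -1)) := by
  rintro σ ⟨hB, hn8, harr⟩
  set σ₁ : RStore := ⟨Function.update σ.nreg 9 0, Function.update σ.rreg 4 ((0 : ℤ) : ℝ), σ.arr⟩
  have h1 : Base D σ₁ := by
    constructor <;> simp [σ₁, hB.n0, hB.n1, hB.n2, hB.n3, hB.n4, hB.n5, hB.n10, hB.r0, hB.r10]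
    exact hB.inp
  obtain ⟨⟨hB', hS, h3⟩, hcost⟩ := count_spec D σ₁ _ ⟨h1, ⟨rfl, rfl, rfl, rfl, rfl, rfl, rfl⟩⟩
  have e8 : σ₁.nreg 8 = t := by simpa [σ₁] using hn8
  have e9 : σ₁.nreg 9 = 0 := by simp [σ₁]
  have e4 : σ₁.rreg 4 = 0 := by simp [σ₁]
  rw [e8, e9, e4] at h3
  simp only [initCand, exec]
  rw [show (⟨Function.update σ.nreg 9 0, Function.update σ.rreg 4 ((0 : ℤ) : ℝ), σ.arr⟩ : RStore) =
    σ₁ from rfl]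
  set τ := (count.exec σ₁).1
  have h4 : τ.rreg 4 = 0 := hS.r4.trans e4
  have n8 : τ.nreg 8 = t := hS.n8.trans e8
  have n9 : τ.nreg 9 = 0 := hS.n9.trans e9
  refine ⟨⟨?_, ?_, ?_, ?_, ?_, ?_, ?_, ?_⟩, by omega⟩
  · constructor <;> simp [hB'.n0, hB'.n1, hB'.n2, hB'.n3, hB'.n4, hB'.n5, hB'.n10, hB'.r0, hB'.r10]
    exact hB'.inp
  · simpa using n8
  · simpa using n9
  · exact hS.arr.trans harr
  · simp
  · simp [hB'.r0, h3, h4]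
  · simp [hB'.r0, h3]
  · rintro j' z ⟨h, -⟩
    omega

/-- The weights for time `t` in array `4` are those of a best classifier. -/
def RowDone (arr : ℕ → ℕ → ℕ → ℕ → ℝ) (t : ℕ) : Prop :=
  ∃ j c, (j < n + n ∨ j = 0) ∧ (∀ j', arr 4 t j' 0 = if j' = j then c else 0) ∧
    errSum D t j c ≤ errSum D t 0 0 ∧
    ∀ j' (z : ℤ), j' < n + n → (z = 1 ∨ z = -1) → errSum D t j c ≤ errSum D t j' (z : ℝ)

/-- Rows from t on are still zero, so a single write leaves a weight vector with at most one
non-zero entry. -/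
theorem timeBody_spec (goal : ℕ → ℝ) (t : ℕ) : Triple
    (fun σ => Base D σ ∧ σ.nreg 8 = t ∧ σ.arr 3 0 0 = goal ∧ (∀ t' < t, RowDone D σ.arr t') ∧
      ∀ t', t ≤ t' → ∀ j l, σ.arr 4 t' j l = 0) timeBody
    ((n + n) * (N * 20 + 18) + N * 10 + 11)
    (fun σ => Base D σ ∧ σ.nreg 8 = t + 1 ∧ σ.arr 3 0 0 = goal ∧
      (∀ t' < t + 1, RowDone D σ.arr t') ∧ ∀ t', t + 1 ≤ t' → ∀ j l, σ.arr 4 t' j l = 0) := by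
  rintro σ ⟨hB, hn8, hgoal, hdone, hzero⟩
  have hspec := (initCand_spec D t σ.arr).seq ((Triple.loop (x := 10)
    (fun j hj => featBody_spec D t j hj σ.arr) (fun σ hσ => hσ.base.n10)).seq (l := 2)
    (d := .seq (.write 4 8 11 3 9) (.nadd 8 8 4))
    (R := fun σ => Base D σ ∧ σ.nreg 8 = t + 1 ∧ σ.arr 3 0 0 = goal ∧
      (∀ t' < t + 1, RowDone D σ.arr t') ∧ ∀ t', t + 1 ≤ t' → ∀ j l, σ.arr 4 t' j l = 0) ?_)
  · obtain ⟨h1, h2⟩ := hspec σ ⟨hB, hn8, rfl⟩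
    exact ⟨h1, h2.trans (by rw [show N * 20 + 17 + 1 = N * 20 + 18 from rfl]; omega)⟩
  intro τ hL
  have hB := hL.base
  have hrow : ∀ t' j l, ((RCmd.seq (.write 4 8 11 3 9) (.nadd 8 8 4)).exec τ).1.arr 4 t' j l =
      if t' = t ∧ j = τ.nreg 11 ∧ l = 0 then τ.rreg 9 else σ.arr 4 t' j l := by
    intro t' j l
    simp [exec, hL.time, hL.arr, hB.n3]
  refine ⟨⟨?_, ?_, ?_, ?_, ?_⟩, le_rfl⟩
  · constructor <;> simp [exec, hB.n0, hB.n1, hB.n2, hB.n3, hB.n4, hB.n5, hB.n10, hB.r0, hB.r10]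
    intro k hk
    rw [← hB.inp k hk]
    funext i' j' l'
    simp [show k ≠ 4 by omega]
  · simp [exec, hL.time, hB.n4]
  · rw [← hgoal]
    funext l
    simp [exec, hL.arr]
  · intro t' ht'
    rcases Nat.lt_succ_iff_lt_or_eq.1 ht' with h | rfl
    · obtain ⟨j, c, hj, hc, hrest⟩ := hdone t' h
      refine ⟨j, c, hj, fun j' => ?_, hrest⟩
      rw [hrow, if_neg (fun h' => h.ne h'.1)]
      exact hc j'
    · refine ⟨τ.nreg 11, τ.rreg 9, hL.mem, fun j' => ?_, ?_, fun j' z hj' hz => ?_⟩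
      · rw [hrow]
        by_cases hj : j' = τ.nreg 11
        · rw [if_pos ⟨rfl, hj, rfl⟩, if_pos hj]
        · rw [if_neg (fun h => hj h.2.1), if_neg hj]
          exact hzero t' le_rfl j' 0
      · rw [← hL.best]; exact hL.zero
      · rw [← hL.best]; exact hL.cand j' z ⟨hj', hz⟩
  · intro t' ht' j l
    rw [hrow, if_neg (fun h => by omega)]
    exact hzero t' (by omega) j l

/-- A bound on the number of steps of the program. -/
def stepBound (N n h : ℕ) : ℕ :=
  6 + (N * 7 + 1) + 1 + (n * 4 + 1) + 1 +
    ((h + 1) * ((n + n) * (N * 20 + 18) + N * 10 + 11 + 1) + 1)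

theorem prog_spec : Triple (fun σ => σ = loadData D) prog (stepBound N n h)
    (fun σ => ∃ g, Best D g ∧ (∀ j < n, σ.arr 3 0 0 j = (loadData D).arr 0 g (h + 1) j) ∧
      ∀ t < h + 1, RowDone D σ.arr t) := by
  intro σ hσ
  obtain ⟨h1, c1⟩ := ((setup_spec D).seq (((Triple.loop (x := 0)
    (fun i (_ : i < N) => goalBody_spec D i) (fun σ hσ => hσ.1.n0)).mono
    (P' := fun σ => Base D σ ∧ σ.nreg 6 = 0 ∧ σ.nreg 7 = 0 ∧ σ.rreg 1 = lastRew D 0 ∧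
      ∀ k, 3 ≤ k → σ.arr k = 0) (fun σ hσ => ⟨hσ.1, hσ.2.1, Or.inr hσ.2.2.1,
        hσ.2.2.1 ▸ hσ.2.2.2.1, by omega, hσ.2.2.2.2⟩) le_rfl (fun _ h => h)))) σ hσ
  set σ₁ := ((RCmd.seq setup (loop 0 goalBody)).exec σ).1 with hσ₁
  obtain ⟨hB, h6, h7, hr, hle, harr⟩ := h1
  have hbest : Best D (σ₁.nreg 7) := ⟨fun h => by omega, fun i hi => by rw [← hr]; exact hle i hi⟩
  have hnext : ∀ (x : ℕ), x = 6 ∨ x = 8 → ∀ τ : RStore, Base D τ →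
      Base D ((RCmd.nconst x 0).exec τ).1 := by
    rintro x hx τ hB
    rcases hx with rfl | rfl <;> constructor <;>
      simp [exec, hB.n0, hB.n1, hB.n2, hB.n3, hB.n4, hB.n5, hB.n10, hB.r0, hB.r10] <;>
      exact hB.inp
  have hcopy := Triple.loop (x := 2) (fun i (_ : i < n) => copyBody_spec D (σ₁.nreg 7) i)
    (fun σ hσ => hσ.1.n2)
  obtain ⟨h2, c2⟩ := hcopy ((RCmd.nconst 6 0).exec σ₁).1 ⟨hnext 6 (Or.inl rfl) σ₁ hB, by simp [exec],
    by simp [exec], by omega, harr 4 (by omega)⟩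
  set σ₂ := ((loop 2 copyBody).exec ((RCmd.nconst 6 0).exec σ₁).1).1 with hσ₂
  obtain ⟨hB2, -, -, hg, h4⟩ := h2
  have htime := Triple.loop (x := 1) (fun t (_ : t < h + 1) => timeBody_spec D (σ₂.arr 3 0 0) t)
    (fun σ hσ => hσ.1.n1)
  obtain ⟨h3, c3⟩ := htime ((RCmd.nconst 8 0).exec σ₂).1 ⟨hnext 8 (Or.inr rfl) σ₂ hB2, by simp [exec],
    rfl, by omega, fun t' _ j l => by simp [exec, h4]⟩
  obtain ⟨-, -, hgoal, hdone, -⟩ := h3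
  refine ⟨⟨σ₁.nreg 7, hbest, fun j hj => ?_, fun t ht => hdone t ht⟩, ?_⟩
  · have : (prog.exec σ).1.arr 3 0 0 = σ₂.arr 3 0 0 := hgoal
    rw [this]
    exact hg j hj
  · have e : (prog.exec σ).2 = (setup.exec σ).2 + (((loop 0 goalBody).exec (setup.exec σ).1).2 +
      (1 + (((loop 2 copyBody).exec ((RCmd.nconst 6 0).exec σ₁).1).2 +
        (1 + ((loop 1 timeBody).exec ((RCmd.nconst 8 0).exec σ₂).1).2)))) := rfl
    have e1 : ((RCmd.seq setup (loop 0 goalBody)).exec σ).2 =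
      (setup.exec σ).2 + ((loop 0 goalBody).exec (setup.exec σ).1).2 := rfl
    rw [e1] at c1
    rw [e, stepBound]
    omega

/-- The real arithmetic of the machine counts correctly: with actions stored as 0 or 1, the error is
1 - a if true is predicted and a otherwise. -/
theorem errSum_eq (t : Fin (h + 1)) (j : Fin (n + n)) (c : ℝ) :
    errSum D t j c = (empErr D t (Pi.single j c) : ℝ) := by
  have hfeat : ∀ i : Fin N, feat D t i j =
      Fin.append ((D i).state t.castSucc).2 ((D i).state (Fin.last (h + 1))).2 j := by
    intro i
    have ht := t.2
    refine Fin.addCases (fun j => ?_) (fun j => ?_) j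
    · rw [Fin.append_left]
      simp [feat, loadData]
      rfl
    · rw [Fin.append_right]
      simp [feat, loadData]
      rfl
  have hact : ∀ i : Fin N, (loadData D).arr 1 i t 0 = bitR ((D i).act t) := by
    intro i
    have ht := t.2
    simp [loadData, show ¬ h < t.1 by omega]
  rw [errSum, ← Fin.sum_univ_eq_sum_range, empErr, Finset.card_filter, Nat.cast_sum]
  refine Finset.sum_congr rfl fun i _ => ?_
  rw [errAt, hfeat, hact, thresh_single]
  by_cases hlt : 0 < c * Fin.append ((D i).state t.castSucc).2 ((D i).state (Fin.last (h + 1))).2 j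
  · cases (D i).act t <;> simp [hlt, bitR]
  · cases (D i).act t <;> simp [hlt, bitR]

/-- The program computes an output of the goal-conditioned algorithm. -/
theorem isGCOutput_prog (hN : 0 < N) (hn : 0 < n) :
    IsGCOutput 1 D (outGoal n (prog.exec (loadData D)).1)
      (outWeights n (h + 1) (prog.exec (loadData D)).1) := by
  obtain ⟨⟨g, ⟨hgN, hbest⟩, hgoal, hrows⟩, -⟩ := prog_spec D (loadData D) rfl
  have hg := hgN hN
  have hrew : ∀ i : Fin N, lastRew D i = (D i).rew (Fin.last h) := by
    intro i
    simp [lastRew, loadData]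
    rfl
  refine ⟨⟨⟨g, hg⟩, ?_, fun i' => ?_⟩, fun t => ?_⟩
  · funext j
    rw [outGoal, hgoal j j.2]
    simp [loadData, hg]
    rfl
  · rw [← hrew, ← hrew]
    exact hbest i' i'.2
  · obtain ⟨j, c, hj, hrow, hz, hcand⟩ := hrows t t.2
    have hj' : j < n + n := by omega
    have hw : outWeights n (h + 1) (prog.exec (loadData D)).1 t =
        Pi.single (⟨j, hj'⟩ : Fin (n + n)) c := by
      funext k
      rw [outWeights, hrow]
      by_cases hk : k.1 = j
      · subst hk; simp
      · rw [if_neg hk, Pi.single_eq_of_ne]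
        exact fun h => hk (congrArg Fin.val h)
    rw [hw]
    refine ⟨l0norm_single_le _ _, fun w' hw' => ?_⟩
    obtain ⟨j', c', rfl⟩ := exists_eq_single_of_l0norm_le (by omega) w' hw'
    -- An arbitrary competitor may be replaced by its sign, and all three signs were tried; sign 0
    -- is the initial candidate, for any coordinate.
    have hle : errSum D t j c ≤ errSum D t j' ((SignType.sign c' : SignType) : ℝ) := by
      rcases lt_trichotomy c' 0 with h | rfl | h
      · have := hcand j' (-1) j'.2 (Or.inr rfl)
        simpa [sign_neg h] using this
      · refine hz.trans_eq ?_
        simp [errSum, errAt]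
      · have := hcand j' 1 j'.2 (Or.inl rfl)
        simpa [sign_pos h] using this
    have e1 := errSum_eq D t ⟨j, hj'⟩ c
    simp only at e1
    rw [e1, errSum_eq, ← empErr_single_sign] at hle
    exact_mod_cast hle

theorem prog_steps_le : (prog.exec (loadData D)).2 ≤ stepBound N n h :=
  (prog_spec D (loadData D) rfl).2

end correctness

end GCProg

/-! ### Polynomial bounds -/

/-- Bound on the sample size, as a polynomial in `H` and `1 / δ`. -/
noncomputable def samplePoly : MvPolynomial (Fin 2) ℝ :=
  MvPolynomial.C 216 * MvPolynomial.X 0 ^ 2 * MvPolynomial.X 1 + 1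

/-- Bound on the running time and the size of the sample, as a polynomial in `H` and `1 / δ`. -/
noncomputable def costPoly : MvPolynomial (Fin 2) ℝ :=
  let H : MvPolynomial (Fin 2) ℝ := MvPolynomial.X 0
  let n : MvPolynomial (Fin 2) ℝ := MvPolynomial.C 3 * H
  samplePoly * ((H + 1) * n + MvPolynomial.C 2 * H) +
    (MvPolynomial.C 6 + (samplePoly * MvPolynomial.C 7 + 1) + 1 + (n * MvPolynomial.C 4 + 1) + 1 +
      (H * ((n + n) * (samplePoly * MvPolynomial.C 20 + MvPolynomial.C 18) +
        samplePoly * MvPolynomial.C 10 + MvPolynomial.C 11 + 1) + 1))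

/-- Both costs are monotone in the dimension, so 3 m + 1 may be enlarged to 3 H; then `costPoly` is
the same expression with N replaced by its bound. -/
theorem cost_le_eval_costPoly (m N : ℕ) (x : ℝ)
    (hN : (N : ℝ) ≤ MvPolynomial.eval ![((m + 2 : ℕ) : ℝ), x] samplePoly) {k : ℕ}
    (hk : k ≤ GCProg.stepBound N (3 * m + 1) (m + 1)) :
    ((recordCost (3 * m + 1) (m + 2) N + k : ℕ) : ℝ) ≤
      MvPolynomial.eval ![((m + 2 : ℕ) : ℝ), x] costPoly := by
  have h1 : ((recordCost (3 * m + 1) (m + 2) N + k : ℕ) : ℝ) ≤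
      ((recordCost (3 * (m + 2)) (m + 2) N + GCProg.stepBound N (3 * (m + 2)) (m + 1) : ℕ) : ℝ) := by
    have hn : 3 * m + 1 ≤ 3 * (m + 2) := by omega
    have h2 : GCProg.stepBound N (3 * m + 1) (m + 1) ≤
        GCProg.stepBound N (3 * (m + 2)) (m + 1) := by
      unfold GCProg.stepBound
      gcongr
    have h3 : recordCost (3 * m + 1) (m + 2) N ≤ recordCost (3 * (m + 2)) (m + 2) N := by
      unfold recordCost
      gcongr
    exact_mod_cast add_le_add h3 (hk.trans h2)
  refine h1.trans ?_
  simp only [costPoly, map_add, map_mul, MvPolynomial.eval_C, MvPolynomial.eval_X, map_one,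
    Matrix.cons_val_zero, GCProg.stepBound, recordCost]
  generalize MvPolynomial.eval ![((m + 2 : ℕ) : ℝ), x] samplePoly = p at hN ⊢
  rw [show m + 1 + 1 = m + 2 from rfl]
  generalize m + 2 = H
  push_cast
  gcongr

theorem theorem1 :
    (∃ (prog : RCmd) (P Q : MvPolynomial (Fin 2) ℝ),
      ∀ (m : ℕ) (δ : ℝ), 0 < δ → δ < 1 →
        ∃ N : ℕ, (N : ℝ) ≤ MvPolynomial.eval ![((m + 2 : ℕ) : ℝ), 1 / δ] P ∧
          (∀ D : Fin N → Traj (3 * m + 1) (m + 2),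
            IsGCOutput 1 D (outGoal (3 * m + 1) (prog.exec (loadData D)).1)
                (outWeights (3 * m + 1) (m + 2) (prog.exec (loadData D)).1) ∧
              ((recordCost (3 * m + 1) (m + 2) N + (prog.exec (loadData D)).2 : ℕ) : ℝ) ≤
                MvPolynomial.eval ![((m + 2 : ℕ) : ℝ), 1 / δ] Q) ∧
          ∀ b : Fin m → Bool,
            ENNReal.ofReal (1 - δ) ≤
              (iidLaw ((familyMDP m b).trajLaw (uniformPolicy (3 * m + 1))) N).toOuterMeasure
                {D | ∀ (g : Fin (3 * m + 1) → ℝ)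
                    (w : Fin (m + 2) → Fin (3 * m + 1 + (3 * m + 1)) → ℝ),
                  IsGCOutput 1 D g w → (familyMDP m b).IsOptimal (gcPolicy g w)}) ∧
    (∀ (A : (m : ℕ) → IAlg.{u, v} (familyStates m)) (K : ℕ → ℕ),
      (fun H : ℕ => (K H : ℝ)) =o[atTop] (fun H : ℕ => (2 : ℝ) ^ H) →
      (∀ (m : ℕ) (b : Fin m → Bool), (A m).CallsLe (familyMDP m b) (K (m + 2))) →
      (∀ (m : ℕ) (b : Fin m → Bool),
        AEMeasurable ((A m).failProb (familyMDP m b)) (A m).seedLaw) →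
      ∀ᶠ m : ℕ in atTop, ∃ b : Fin m → Bool,
        (1 / 3 : ENNReal) ≤ ∫⁻ ω, (A m).failProb (familyMDP m b) ω ∂(A m).seedLaw) := by
  refine ⟨⟨GCProg.prog, samplePoly, costPoly, fun m δ hδ _ => ?_⟩,
    fun A K hKo hK hA => interface_lower_bound A K hKo hK hA⟩
  -- The sample size is the ceiling of this number. Positivity makes the sample nonempty, so that a
  -- goal exists; rounding is absorbed by the summand 1 of `samplePoly`.
  have hpos : 0 < 216 * ((m + 2 : ℕ) : ℝ) ^ 2 * (1 / δ) := by positivity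
  have hN : ((⌈216 * ((m + 2 : ℕ) : ℝ) ^ 2 * (1 / δ)⌉₊ : ℕ) : ℝ) ≤
      MvPolynomial.eval ![((m + 2 : ℕ) : ℝ), 1 / δ] samplePoly := by
    refine (Nat.ceil_lt_add_one hpos.le).le.trans_eq ?_
    simp only [samplePoly, map_add, map_mul, map_pow, MvPolynomial.eval_C, MvPolynomial.eval_X,
      map_one, Matrix.cons_val_zero, Matrix.cons_val_one]
  refine ⟨_, hN, fun D => ⟨?_, ?_⟩, fun b => ?_⟩
  · exact GCProg.isGCOutput_prog D (Nat.ceil_pos.2 hpos) (Nat.succ_pos _)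
  · exact cost_le_eval_costPoly m _ _ hN (GCProg.prog_steps_le D)
  · exact iidLaw_gcPolicy_isOptimal b hδ (Nat.le_ceil _)
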